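/- Let $\mathbb F_q$ be a finite field with $q$ elements, let $\mathcal R_q$ be the ring of quantum integer-valued polynomials for this $q$, written in the variable $t$ (where $t=1+(q-1)x$ and $x=[n]_q$ corresponds to $t=q^n$), that is $$\mathcal R_q=\{f\in\mathbb Q[t] : f(q^n)\in\mathbb Z[q,q^{-1}]\text{ for all } n\in\mathbb Z\}.$$ Let $\Phi_q$ be the set of monic irreducible polynomials in $\mathbb F_q[t]$ other than $t$. A multipartition is a function $\boldsymbol\mu$ from $\Phi_q$ to the set of partitions, empty at all but finitely many $r\in\Phi_q$; its size is $|\boldsymbol\mu|=\sum_{r}\deg(r)\,|\boldsymbol\mu(r)|$. An element $g\in GL_m(\mathbb F_q)$ has type $\boldsymbol\mu$ if, for all $r\in\Phi_q$ and $i\ge 1$, the number of parts of $\boldsymbol\mu(r)$ equal to $i$ is the multiplicity of $r^i$ as an elementary divisor of the $\mathbb F_q[t]$-module $\mathbb F_q^m$ on which $t$ acts by $g$. The modified type of $g$ is obtained from its type by subtracting $1$ from each part of the partition at $t-1$. Let $X_{\boldsymbol\mu,m}$ be the sum of all elements of $GL_m(\mathbb F_q)$ of modified type $\boldsymbol\mu$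 in the group algebra (it is $0$ if there are none). There is a unique family of elements $r_{\boldsymbol\mu,\boldsymbol\nu}^{\boldsymbol\lambda}\in\mathcal R_q$, indexed by triples of multipartitions, with only finitely many $r_{\boldsymbol\mu,\boldsymbol\nu}^{\boldsymbol\lambda}$ nonzero for given $\boldsymbol\mu,\boldsymbol\nu$, such that for all $\boldsymbol\mu,\boldsymbol\nu$ and all integers $m\ge 0$ $$X_{\boldsymbol\mu,m}X_{\boldsymbol\nu,m}=\sum_{\boldsymbol\lambda}r_{\boldsymbol\mu,\boldsymbol\nu}^{\boldsymbol\lambda}(q^m)\,X_{\boldsymbol\lambda,m}.$$ This family has the following properties. 1. Each $r_{\boldsymbol\mu,\boldsymbol\nu}^{\boldsymbol\lambda}$, as a polynomial in $t=q^m$, has degree at most $2(|\boldsymbol\mu|+|\boldsymbol\nu|-|\boldsymbol\lambda|)$; in particular it is the zero polynomial if this bound is negative. 2. Let $\mathrm{FH}_q^{GL}$ be the free $\mathcal R_q$-module with basis the symbols $K_{\boldsymbol\mu}$, with the $\mathcal R_q$-bilinear multiplication $K_{\boldsymbol\mu}K_{\boldsymbol\nu}=\sum_{\boldsymbol\lambda}r_{\boldsymbol\mu,\boldsymbol\nu}^{\boldsymbol\lambda}K_{\boldsymbol\lambda}$,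 and let $F_d$ ($d\ge 0$) be the $\mathcal R_q$-span of the $K_{\boldsymbol\mu}$ with $|\boldsymbol\mu|\le d$. Then $\mathrm{FH}_q^{GL}$ is a commutative associative algebra with unit $K_\varnothing$, and $(F_d)_{d\ge0}$ is an exhaustive increasing algebra filtration of it: $1\in F_0$ and $F_iF_j\subseteq F_{i+j}$. 3. The classes of the $K_{\boldsymbol\mu}$ in $F_{|\boldsymbol\mu|}/F_{|\boldsymbol\mu|-1}$ (with $F_{-1}=0$) form an $\mathcal R_q$-basis of the associated graded algebra $\bigoplus_{d\ge 0}F_d/F_{d-1}$, and all structure constants of the associated graded algebra in this basis are integers. -/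

import Mathlib

open Polynomial DirectSum

noncomputable section

namespace FarahatHigman

/-! ### Quantum integer-valued polynomials -/

/-- The ring `ℛ_q` for a fixed positive integer `q`, in the variable `t` (so that `t = q ^ n`
corresponds to `x = [n]_q` under `t = 1 + (q - 1) x`): the polynomials `f ∈ ℚ[t]` such that
`f (q ^ n) ∈ ℤ[q, q⁻¹]` for all `n ∈ ℤ`. -/
def QIVP (q : ℕ) : Subring ℚ[X] where
  carrier := {f | ∀ n : ℤ, f.eval ((q : ℚ) ^ n) ∈ Algebra.adjoin ℤ ({(q : ℚ), (q : ℚ)⁻¹} : Set ℚ)}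
  mul_mem' hf hg n := by
    rw [eval_mul]; exact mul_mem (hf n) (hg n)
  one_mem' n := by
    rw [eval_one]; exact one_mem _
  add_mem' hf hg n := by
    rw [eval_add]; exact add_mem (hf n) (hg n)
  zero_mem' n := by
    rw [eval_zero]; exact zero_mem _
  neg_mem' hf n := by
    rw [eval_neg]; exact neg_mem (hf n)

/-! ### Multipartitions and types of invertible matrices -/

/-- A partition, as the multiset of its nonzero parts; `s.count i` is the multiplicity `m_i`. -/
abbrev Part : Type := Multiset ℕ+

/-- The size of a partition: the sum of its parts. -/
def Part.size (s : Part) : ℕ := (s.map (fun i : ℕ+ => (i : ℕ))).sum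

/-- Delete the first column of the Young diagram: subtract `1` from each part
(parts equal to `1` disappear). -/
def Part.removeColumn (s : Part) : Part := (s.filter (fun i => 1 < i)).map (fun i => i - 1)

/-- The set `Φ` of monic irreducible polynomials over `F` different from `t`. -/
abbrev Phi (F : Type*) [Field F] : Type _ := {p : F[X] // p.Monic ∧ Irreducible p ∧ p ≠ X}

/-- The polynomial `t - 1` as an element of `Φ`. -/
def phiOne (F : Type*) [Field F] : Phi F :=
  ⟨X - C 1, monic_X_sub_C 1, irreducible_X_sub_C 1, fun h => by
    have := congrArg (Polynomial.eval 0) h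
    simp at this⟩

/-- Multipartitions: functions from `Φ` to partitions, of finite size (i.e. nonempty at only
finitely many elements of `Φ`). -/
abbrev MultiPart (F : Type*) [Field F] : Type _ := Phi F →₀ Part

/-- The size `|μ| = ∑_r deg(r) |μ(r)|` of a multipartition. -/
def MultiPart.size {F : Type*} [Field F] (μ : MultiPart F) : ℕ :=
  μ.sum fun p s => p.1.natDegree * Part.size s

/-- `g` has type `μ`: the elementary divisors of the `F[t]`-module `F ^ m` on which `t` acts by `g`
are the `r ^ i`, for `r ∈ Φ` and `i ≥ 1`, with multiplicity `m_i(μ(r))`. -/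
def HasType {F : Type*} [Field F] {m : ℕ} (g : GL (Fin m) F) (μ : MultiPart F) : Prop :=
  Nonempty (Module.AEval' (Matrix.toLin' (g : Matrix (Fin m) (Fin m) F)) ≃ₗ[F[X]]
    ⨁ j : (Σ x : Phi F × ℕ+, Fin ((μ x.1).count x.2)),
      F[X] ⧸ Ideal.span {j.1.1.1 ^ (j.1.2 : ℕ)})

/-- From a type to the modified type: delete the first column of the partition at `t - 1`. -/
def MultiPart.modified {F : Type*} [Field F] (μ : MultiPart F) : MultiPart F :=
  μ.update (phiOne F) (Part.removeColumn (μ (phiOne F)))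

/-- `g` has modified type `ν`. -/
def HasModifiedType {F : Type*} [Field F] {m : ℕ} (g : GL (Fin m) F) (ν : MultiPart F) : Prop :=
  ∃ μ : MultiPart F, HasType g μ ∧ μ.modified = ν

open Classical in
/-- The sum `X_{ν,m}` of all elements of `GL_m(F)` of modified type `ν`. It has integer
coefficients and is regarded inside the rational group algebra, because the values of elements of
`ℛ_q` are only in `ℤ[q, q⁻¹]` in general. -/
def classSum {F : Type*} [Field F] [Fintype F] (m : ℕ) (ν : MultiPart F) :
    MonoidAlgebra ℚ (GL (Fin m) F) :=
  ∑ g : GL (Fin m) F with HasModifiedType g ν, MonoidAlgebra.single g 1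

/-! ### The structure polynomials and the Farahat–Higman algebra -/

/-- A family of elements `r μ ν lam` of `ℛ_q`, `q = |F|`, where for fixed `μ`, `ν` only finitely
many are nonzero. -/
abbrev Family (F : Type*) [Field F] [Fintype F] : Type _ :=
  MultiPart F → MultiPart F → (MultiPart F →₀ QIVP (Fintype.card F))

/-- The family `r` interpolates the structure constants of the centres of the group algebras:
`X_{μ,m} X_{ν,m} = ∑_lam r_{μν}^lam(q ^ m) X_{lam,m}` for all `m ≥ 0` and all `μ`, `ν`. -/
def Interpolates {F : Type*} [Field F] [Fintype F] (r : Family F) : Prop :=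
  ∀ (m : ℕ) (μ ν : MultiPart F),
    classSum m μ * classSum m ν =
      (r μ ν).sum fun lam c => (c : ℚ[X]).eval ((Fintype.card F : ℚ) ^ m) • classSum m lam

/-- The free `ℛ_q`-module on symbols `K_μ`, carrying the multiplication with
structure constants `r`. -/
def FH {F : Type*} [Field F] [Fintype F] (_r : Family F) : Type _ :=
  MultiPart F →₀ QIVP (Fintype.card F)

section

variable {F : Type*} [Field F] [Fintype F] (r : Family F)

instance : AddCommGroup (FH r) :=
  inferInstanceAs (AddCommGroup (MultiPart F →₀ QIVP (Fintype.card F)))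

instance : Module (QIVP (Fintype.card F)) (FH r) :=
  inferInstanceAs (Module (QIVP (Fintype.card F)) (MultiPart F →₀ QIVP (Fintype.card F)))

/-- The basis of symbols `K_μ`. -/
def FH.basis : Module.Basis (MultiPart F) (QIVP (Fintype.card F)) (FH r) :=
  Module.Basis.ofRepr (LinearEquiv.refl (QIVP (Fintype.card F))
    (MultiPart F →₀ QIVP (Fintype.card F)))

/-- The basis element `K_μ`. -/
def FH.K (μ : MultiPart F) : FH r := FH.basis r μ

/-- The bilinear multiplication with `K_μ K_ν = ∑_lam r_{μν}^lam K_lam`. -/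
def FH.mulHom : FH r →ₗ[QIVP (Fintype.card F)] FH r →ₗ[QIVP (Fintype.card F)] FH r :=
  (FH.basis r).constr (QIVP (Fintype.card F)) fun μ =>
    (FH.basis r).constr (QIVP (Fintype.card F)) fun ν =>
      (r μ ν).sum fun lam c => c • FH.K r lam

instance : NonUnitalNonAssocRing (FH r) where
  mul x y := FH.mulHom r x y
  left_distrib x y z := map_add (FH.mulHom r x) y z
  right_distrib x y z := by
    change FH.mulHom r (x + y) z = FH.mulHom r x z + FH.mulHom r y z
    rw [map_add, LinearMap.add_apply]
  zero_mul x := by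
    change FH.mulHom r 0 x = 0
    rw [map_zero, LinearMap.zero_apply]
  mul_zero x := map_zero (FH.mulHom r x)

/-- The element `K_∅`. -/
instance : One (FH r) := ⟨FH.K r 0⟩

instance : IsScalarTower (QIVP (Fintype.card F)) (FH r) (FH r) where
  smul_assoc c x y := by
    change FH.mulHom r (c • x) y = c • FH.mulHom r x y
    rw [map_smul, LinearMap.smul_apply]

instance : SMulCommClass (QIVP (Fintype.card F)) (FH r) (FH r) where
  smul_comm c x y := ((FH.mulHom r x).map_smul c y).symm

theorem FH.K_mul_K (μ ν : MultiPart F) :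
    FH.K r μ * FH.K r ν = (r μ ν).sum fun lam c => c • FH.K r lam := by
  change FH.mulHom r (FH.basis r μ) (FH.basis r ν) = _
  rw [FH.mulHom, Module.Basis.constr_basis, Module.Basis.constr_basis]

/-- The filtration piece `F_d`: the span of the `K_μ` with `|μ| ≤ d`. -/
def FH.filtration (d : ℕ) : Submodule (QIVP (Fintype.card F)) (FH r) :=
  Submodule.span _ {x | ∃ μ : MultiPart F, μ.size ≤ d ∧ x = FH.K r μ}

theorem FH.K_mem (μ : MultiPart F) : FH.K r μ ∈ FH.filtration r μ.size :=
  Submodule.subset_span ⟨μ, le_rfl, rfl⟩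

end

/-! ### Filtered algebras and their associated graded algebras -/

section

variable {R A : Type*} [CommRing R] [NonUnitalNonAssocRing A] [Module R A]

/-- `(A, F)` is a filtered algebra: `A` is a commutative, associative and unital `R`-algebra and
`F_0 ⊆ F_1 ⊆ …` is an exhaustive increasing filtration of it by submodules such that `1 ∈ F_0` and
`F_i F_j ⊆ F_{i+j}`. -/
structure IsFilteredCommAlgebra [One A] [IsScalarTower R A A] [SMulCommClass R A A]
    (F : ℕ → Submodule R A) : Prop where
  mul_assoc : ∀ x y z : A, x * y * z = x * (y * z)
  mul_comm : ∀ x y : A, x * y = y * x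
  one_mul : ∀ x : A, 1 * x = x
  mono : Monotone F
  one_mem : (1 : A) ∈ F 0
  mul_mem : ∀ (i j : ℕ) (x y : A), x ∈ F i → y ∈ F j → x * y ∈ F (i + j)
  exhaustive : ∀ x : A, ∃ d, x ∈ F d

theorem IsFilteredCommAlgebra.gradedMul [One A] [IsScalarTower R A A] [SMulCommClass R A A]
    {F : ℕ → Submodule R A} (h : IsFilteredCommAlgebra F) : SetLike.GradedMul F :=
  ⟨fun {i j x y} hx hy => h.mul_mem i j x y hx hy⟩

/-- The sum of the filtration pieces of index `< d` (for an increasing filtration this is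
`F_{d-1}`, and `0` for `d = 0`). -/
def below (F : ℕ → Submodule R A) (d : ℕ) : Submodule R A := ⨆ i : Fin d, F i

/-- The `d`-th graded piece `F_d / F_{d-1}`. -/
abbrev GrPiece (F : ℕ → Submodule R A) (d : ℕ) : Type _ :=
  F d ⧸ (below F d).submoduleOf (F d)

/-- The class in `F_d / F_{d-1}` of an element of `F_d`. -/
def GrPiece.mk (F : ℕ → Submodule R A) (d : ℕ) : F d →ₗ[R] GrPiece F d :=
  ((below F d).submoduleOf (F d)).mkQ

theorem mul_below_left [IsScalarTower R A A] (F : ℕ → Submodule R A) [SetLike.GradedMul F] {i j : ℕ} {x y : A}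
    (hx : x ∈ below F i) (hy : y ∈ F j) : x * y ∈ below F (i + j) := by
  have : below F i ≤ (below F (i + j)).comap (LinearMap.mulRight R y) := by
    refine iSup_le fun k z hz => ?_
    exact Submodule.mem_iSup_of_mem (⟨k + j, by omega⟩ : Fin (i + j)) (SetLike.mul_mem_graded hz hy)
  exact this hx

theorem mul_below_right [SMulCommClass R A A] (F : ℕ → Submodule R A) [SetLike.GradedMul F] {i j : ℕ} {x y : A}
    (hx : x ∈ F i) (hy : y ∈ below F j) : x * y ∈ below F (i + j) := by
  have : below F j ≤ (below F (i + j)).comap (LinearMap.mulLeft R x) := by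
    refine iSup_le fun k z hz => ?_
    exact Submodule.mem_iSup_of_mem (⟨i + k, by omega⟩ : Fin (i + j)) (SetLike.mul_mem_graded hx hz)
  exact this hy

variable [IsScalarTower R A A] [SMulCommClass R A A]

/-- The product `F_i × F_j → F_{i+j}`. -/
def pieceMul (F : ℕ → Submodule R A) [SetLike.GradedMul F] (i j : ℕ) :
    F i →ₗ[R] F j →ₗ[R] F (i + j) :=
  LinearMap.mk₂ R (fun x y => ⟨(x : A) * (y : A), SetLike.mul_mem_graded x.2 y.2⟩)
    (fun x x' y => Subtype.ext (add_mul (x : A) x' y))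
    (fun c x y => Subtype.ext (smul_mul_assoc c (x : A) (y : A)))
    (fun x y y' => Subtype.ext (mul_add (x : A) y y'))
    (fun c x y => Subtype.ext (mul_smul_comm c (x : A) (y : A)))

/-- The induced product `F_i/F_{i-1} × F_j/F_{j-1} → F_{i+j}/F_{i+j-1}`. -/
def GrPiece.mul (F : ℕ → Submodule R A) [SetLike.GradedMul F] (i j : ℕ) :
    GrPiece F i →ₗ[R] GrPiece F j →ₗ[R] GrPiece F (i + j) :=
  ((below F i).submoduleOf (F i)).liftQ
    (LinearMap.flip (((below F j).submoduleOf (F j)).liftQ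
      (LinearMap.flip ((pieceMul F i j).compr₂ (GrPiece.mk F (i + j))))
      (fun y hy => LinearMap.ext fun x => (Submodule.Quotient.mk_eq_zero _).2
        (mul_below_right F x.2 hy))))
    (fun x hx => LinearMap.ext fun y => by
      obtain ⟨y, rfl⟩ := Submodule.mkQ_surjective _ y
      exact (Submodule.Quotient.mk_eq_zero _).2 (mul_below_left F hx y.2))

theorem GrPiece.mul_mk (F : ℕ → Submodule R A) [SetLike.GradedMul F] (i j : ℕ)
    (x : F i) (y : F j) :
    GrPiece.mul F i j (GrPiece.mk F i x) (GrPiece.mk F j y) =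
      GrPiece.mk F (i + j) ⟨(x : A) * (y : A), SetLike.mul_mem_graded x.2 y.2⟩ := rfl

/-- The product on `⨁_d F_d/F_{d-1}` is the one induced by multiplication of representatives. -/
instance (F : ℕ → Submodule R A) [SetLike.GradedMul F] :
    DirectSum.GNonUnitalNonAssocSemiring (GrPiece F) where
  mul {i j} x y := GrPiece.mul F i j x y
  mul_zero {i j} x := map_zero (GrPiece.mul F i j x)
  zero_mul {i j} y := by
    change GrPiece.mul F i j 0 y = 0
    rw [map_zero, LinearMap.zero_apply]
  mul_add {i j} x y z := map_add (GrPiece.mul F i j x) y z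
  add_mul {i j} x y z := by
    rw [map_add, LinearMap.add_apply]

/-- The associated graded algebra `⨁_d F_d/F_{d-1}`; its multiplication is available as soon as
`F_i F_j ⊆ F_{i+j}`. -/
abbrev AssocGraded (F : ℕ → Submodule R A) : Type _ := ⨁ d, GrPiece F d

end

/-- The class of `K_μ` in the degree `|μ|` piece of the associated graded algebra. -/
def FH.symbol {F : Type*} [Field F] [Fintype F] (r : Family F) (μ : MultiPart F) :
    AssocGraded (FH.filtration r) :=
  DirectSum.of (GrPiece (FH.filtration r)) μ.size
    (GrPiece.mk (FH.filtration r) μ.size ⟨FH.K r μ, FH.K_mem r μ⟩)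

end FarahatHigman

end

/-! The modified type of `1 + a` sees only the nontrivial part of `a`. If `a = u * v` with `u`
injective and `v` surjective, it is the type of the corner `1 + v * u` (`MatrixHasType.corner`), and
its size is the rank of `a`. This description no longer mentions `m`.

The coefficient of `1 + c` in a product of two class sums is the number of pairs `(a, b)` of
prescribed modified types with `(1 + a) * (1 + b) = 1 + c`. Write `a = u * α * v` and `b = u * β *
v`, where `u` is injective onto the sum of the images and `v` is surjective with kernel the
intersection of the kernels. Such frames form a torsor under a product of two general linear groups.
The type conditions depend only on `α`, `β` and `B = v * u`, and the product condition reads `u * M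
* v = c` with `M = α + β + α * B * β`. Hence the coefficient is a finite rational combination,
independent of `m`, of the numbers `pairCount M B c` (`natCard_factorPair`).

Each of these is a polynomial in `q ^ m` (`isPolynomialCount_pairCount`). A kernel vector of `M` on
either side frees one column of `u` or row of `v`, and contributes a factor linear in `q ^ m`. Once
`M` is invertible the count is constant, and it vanishes unless `M` has the size of the rank of `c`.
As `M` has at most `|μ| + |ν|` rows and columns, counting the linear factors gives the degree bound.

Values at large powers of `q` are cardinalities, and a `q`-difference induction puts the polynomial
in `QIVP` (`mem_QIVP_of_eval_mem`). Every class is nonempty for large `m`, so the specializations to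
the group algebras of all `GL_m` are jointly injective (`specialize_injective`). This gives
uniqueness of the family and transports associativity, commutativity and the unit. In top degree the
bound leaves only constants, which are cardinalities and so integers. -/

noncomputable section

namespace FarahatHigman

set_option linter.unusedSectionVars false

/-! ### Types of torsion modules and their kernel-counting invariants -/

section Types

/-- The index set of the elementary divisors in a module of type `μ`. -/
abbrev DivisorIndex {F : Type*} [Field F] (μ : MultiPart F) : Type _ :=
  Σ x : Phi F × ℕ+, Fin ((μ x.1).count x.2)

/-- The `F[t]`-module `V` has type `μ`. -/
def ModuleHasType {F : Type*} [Field F] (V : Type*) [AddCommGroup V] [Module F[X] V]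
    (μ : MultiPart F) : Prop :=
  Nonempty (V ≃ₗ[F[X]] ⨁ j : DivisorIndex μ, F[X] ⧸ Ideal.span {j.1.1.1 ^ (j.1.2 : ℕ)})

variable {F : Type*} [Field F]

/-- The pairs `(r, i)` for which `r ^ i` is an elementary divisor. -/
def divisorSupport (μ : MultiPart F) : Finset (Phi F × ℕ+) :=
  μ.support.sigma (fun p => (μ p).toFinset) |>.map
    ⟨fun x => (x.1, x.2), fun x y h => by
      obtain ⟨a, b⟩ := x; obtain ⟨c, d⟩ := y; simpa using h⟩

theorem mem_divisorSupport (μ : MultiPart F) (x : Phi F × ℕ+) :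
    x ∈ divisorSupport μ ↔ x.2 ∈ μ x.1 := by
  obtain ⟨p, i⟩ := x
  simp only [divisorSupport, Finset.mem_map, Finset.mem_sigma, Finsupp.mem_support_iff,
    Multiset.mem_toFinset]
  constructor
  · rintro ⟨⟨a, b⟩, ⟨-, h⟩, h2⟩
    obtain ⟨rfl, rfl⟩ := Prod.mk.inj h2
    exact h
  · intro h
    exact ⟨⟨p, i⟩, ⟨fun h0 => by simp [h0] at h, h⟩, rfl⟩

/-- The pairs `(r, i)` range over an infinite set; discarding the empty fibres leaves a visibly
finite index set. -/
def divisorIndexEquiv (μ : MultiPart F) :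
    DivisorIndex μ ≃ Σ x : divisorSupport μ, Fin ((μ x.1.1).count x.1.2) where
  toFun j := ⟨⟨j.1, (mem_divisorSupport μ j.1).2 (Multiset.count_pos.1
    (lt_of_le_of_lt (Nat.zero_le _) j.2.2))⟩, j.2⟩
  invFun j := ⟨j.1.1, j.2⟩
  left_inv _ := rfl
  right_inv _ := rfl

instance (μ : MultiPart F) : Fintype (DivisorIndex μ) :=
  Fintype.ofEquiv _ (divisorIndexEquiv μ).symm

/-- Sums over all elementary divisors, computed prime by prime. -/
theorem sum_divisorIndex (μ : MultiPart F) (φ : Phi F → ℕ+ → ℕ) :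
    ∑ j : DivisorIndex μ, φ j.1.1 j.1.2 = μ.sum fun p s => (s.map (φ p)).sum := by
  rw [← (divisorIndexEquiv μ).symm.sum_comp]
  rw [Fintype.sum_sigma]
  simp only [divisorIndexEquiv, Equiv.coe_fn_symm_mk, Finset.sum_const, Finset.card_univ,
    Fintype.card_fin, smul_eq_mul]
  rw [Finset.sum_coe_sort (divisorSupport μ) (fun x => (μ x.1).count x.2 * φ x.1 x.2)]
  rw [divisorSupport, Finset.sum_map, Finset.sum_sigma, Finsupp.sum]
  refine Finset.sum_congr rfl fun p _ => ?_
  rw [Finset.sum_multiset_map_count]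
  rfl

/-- The number of elements of `V` killed by `f`. -/
def kerCard (V : Type*) [AddCommGroup V] [Module F[X] V] (f : F[X]) : ℕ :=
  Nat.card {x : V // f • x = 0}

theorem kerCard_congr {V W : Type*} [AddCommGroup V] [Module F[X] V] [AddCommGroup W]
    [Module F[X] W] (e : V ≃ₗ[F[X]] W) (f : F[X]) : kerCard V f = kerCard W f := by
  refine Nat.card_congr (e.toEquiv.subtypeEquiv fun x => ?_)
  change f • x = 0 ↔ f • e x = 0
  rw [← map_smul, e.map_eq_zero_iff]

theorem kerCard_pi {ι : Type*} [Fintype ι] (V : ι → Type*) [∀ i, AddCommGroup (V i)]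
    [∀ i, Module F[X] (V i)] (f : F[X]) : kerCard (∀ i, V i) f = ∏ i, kerCard (V i) f := by
  unfold kerCard
  rw [← Nat.card_pi]
  refine Nat.card_congr (Equiv.trans (Equiv.subtypeEquivRight fun x => ?_)
    Equiv.subtypePiEquivPi)
  exact funext_iff

theorem natCard_quotient_span [Fintype F] {f : F[X]} (hf : f ≠ 0) :
    Nat.card (F[X] ⧸ Ideal.span {f}) = Fintype.card F ^ f.natDegree := by
  have : Module.Finite F (F[X] ⧸ Ideal.span {f}) := by
    exact (AdjoinRoot.powerBasis hf).finite
  rw [Module.natCard_eq_pow_finrank (K := F), finrank_quotient_span_eq_natDegree,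
    Nat.card_eq_fintype_card]

theorem finite_quotient_span [Fintype F] {f : F[X]} (hf : f ≠ 0) :
    Finite (F[X] ⧸ Ideal.span {f}) := by
  have : Module.Finite F (F[X] ⧸ Ideal.span {f}) := by
    exact (AdjoinRoot.powerBasis hf).finite
  exact Module.finite_of_finite F

/-- On a finite module, multiplication by `f` has kernel and cokernel of the same order, and here
the cokernel is the quotient by the ideal `(h, f)`. -/
theorem kerCard_quotient [Fintype F] {h : F[X]} (hh : h ≠ 0) (f : F[X]) :
    kerCard (F[X] ⧸ Ideal.span {h}) f =
      Nat.card (F[X] ⧸ (Ideal.span {h} ⊔ Ideal.span {f})) := by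
  have := finite_quotient_span hh
  set V := F[X] ⧸ Ideal.span {h}
  let φ : V →ₗ[F[X]] V := LinearMap.lsmul F[X] V f
  have h1 : Nat.card V = Nat.card (LinearMap.range φ) * Nat.card (V ⧸ LinearMap.range φ) :=
    Submodule.card_eq_card_quotient_mul_card _
  have h2 : Nat.card V = Nat.card (LinearMap.ker φ) * Nat.card (V ⧸ LinearMap.ker φ) :=
    Submodule.card_eq_card_quotient_mul_card _
  have h3 : Nat.card (V ⧸ LinearMap.ker φ) = Nat.card (LinearMap.range φ) :=
    Nat.card_congr φ.quotKerEquivRange.toEquiv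
  have h4 : 0 < Nat.card (LinearMap.range φ) := Nat.card_pos
  have h5 : Nat.card (LinearMap.ker φ) = Nat.card (V ⧸ LinearMap.range φ) := by
    rw [h3, h1, mul_comm] at h2
    exact (Nat.eq_of_mul_eq_mul_right h4 h2).symm
  have h6 : kerCard V f = Nat.card (LinearMap.ker φ) := rfl
  rw [h6, h5]
  have h7 : (LinearMap.range φ : Set V) =
      ((Ideal.span {f}).map (Ideal.Quotient.mk (Ideal.span {h})) : Set V) := by
    ext x
    rw [Ideal.map_span, Set.image_singleton]
    simp only [SetLike.mem_coe, LinearMap.mem_range, Ideal.mem_span_singleton']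
    have hsmul : ∀ y : V, f • y = y * Ideal.Quotient.mk (Ideal.span {h}) f := by
      intro y
      obtain ⟨y, rfl⟩ := Ideal.Quotient.mk_surjective y
      rw [mul_comm]
      rfl
    constructor
    · rintro ⟨y, rfl⟩
      exact ⟨y, (hsmul y).symm⟩
    · rintro ⟨y, rfl⟩
      exact ⟨y, hsmul y⟩
  have h8 : Nat.card (V ⧸ LinearMap.range φ) =
      Nat.card (V ⧸ ((Ideal.span {f}).map (Ideal.Quotient.mk (Ideal.span {h})))) := by
    have : (LinearMap.range φ).toAddSubgroup =
      ((Ideal.span {f}).map (Ideal.Quotient.mk (Ideal.span {h}))).toAddSubgroup :=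
      SetLike.coe_injective h7
    exact Nat.card_congr (QuotientAddGroup.quotientAddEquivOfEq this).toEquiv
  rw [h8]
  exact Nat.card_congr (DoubleQuot.quotQuotEquivQuotSup _ _).toEquiv

open Classical in
theorem kerCard_quotient_prime_pow [Fintype F] (p r : Phi F) (i n : ℕ) :
    kerCard (F[X] ⧸ Ideal.span {r.1 ^ i}) (p.1 ^ n) =
      Fintype.card F ^ (if r = p then p.1.natDegree * min i n else 0) := by
  rw [kerCard_quotient (pow_ne_zero _ r.2.2.1.ne_zero)]
  split_ifs with hrp
  · subst hrp
    have : Ideal.span {r.1 ^ i} ⊔ Ideal.span {r.1 ^ n} = Ideal.span {r.1 ^ min i n} := by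
      rcases le_total i n with h | h
      · rw [min_eq_left h, sup_eq_left]
        exact Ideal.span_singleton_le_span_singleton.2 (pow_dvd_pow _ h)
      · rw [min_eq_right h, sup_eq_right]
        exact Ideal.span_singleton_le_span_singleton.2 (pow_dvd_pow _ h)
    rw [this, natCard_quotient_span (pow_ne_zero _ r.2.2.1.ne_zero), r.2.1.natDegree_pow,
      mul_comm]
  · have hc : IsCoprime r.1 p.1 := by
      refine (Irreducible.coprime_iff_not_dvd r.2.2.1).2 fun hd => hrp (Subtype.ext ?_)
      exact eq_of_monic_of_associated r.2.1 p.2.1 (r.2.2.1.associated_of_dvd p.2.2.1 hd)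
    have : Ideal.span {r.1 ^ i} ⊔ Ideal.span {p.1 ^ n} = ⊤ := by
      rw [← Ideal.isCoprime_iff_sup_eq, Ideal.isCoprime_span_singleton_iff]
      exact hc.pow
    rw [this, pow_zero]
    exact Nat.card_unique

/-- The size of the first `n` columns of a partition. -/
def Part.columns (s : Part) (n : ℕ) : ℕ := (s.map fun i : ℕ+ => min (i : ℕ) n).sum

theorem kerCard_of_type [Fintype F] {V : Type*} [AddCommGroup V] [Module F[X] V]
    {μ : MultiPart F} (hV : ModuleHasType V μ) (p : Phi F) (n : ℕ) :
    kerCard V (p.1 ^ n) = Fintype.card F ^ (p.1.natDegree * Part.columns (μ p) n) := by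
  classical
  obtain ⟨e⟩ := hV
  rw [kerCard_congr (e.trans (DirectSum.linearEquivFunOnFintype F[X] _ _)), kerCard_pi]
  simp only [kerCard_quotient_prime_pow]
  rw [Finset.prod_pow_eq_pow_sum, sum_divisorIndex μ
    (fun r i => if r = p then p.1.natDegree * min (i : ℕ) n else 0)]
  congr 1
  rw [Finsupp.sum, Finset.sum_eq_single p]
  · simp [Part.columns, Multiset.sum_map_mul_left]
  · intro r _ hr
    simp [hr]
  · intro hp
    rw [Finsupp.notMem_support_iff.1 hp]
    simp

theorem natCard_of_type [Fintype F] {V : Type*} [AddCommGroup V] [Module F[X] V]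
    {μ : MultiPart F} (hV : ModuleHasType V μ) : Nat.card V = Fintype.card F ^ μ.size := by
  obtain ⟨e⟩ := hV
  rw [Nat.card_congr (e.trans (DirectSum.linearEquivFunOnFintype F[X] _ _)).toEquiv, Nat.card_pi]
  rw [Finset.prod_congr rfl fun j _ => natCard_quotient_span
    (pow_ne_zero _ j.1.1.2.2.1.ne_zero)]
  rw [Finset.prod_pow_eq_pow_sum]
  rw [Finset.sum_congr rfl fun j _ => j.1.1.2.1.natDegree_pow _]
  rw [sum_divisorIndex μ (fun r i => i * r.1.natDegree)]
  congr 1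
  refine Finset.sum_congr rfl fun p _ => ?_
  change (Multiset.map (fun i : ℕ+ => (i : ℕ) * p.1.natDegree) (μ p)).sum = _
  rw [Multiset.sum_map_mul_right, mul_comm]
  rfl

/-- First differences of `columns` count the parts larger than `n`, and differences of those counts
are the multiplicities. -/
theorem Part.ext_columns {s t : Part} (h : ∀ n, s.columns n = t.columns n) : s = t := by
  have key : ∀ (s : Part) (n : ℕ), Part.columns s (n + 1) =
      Part.columns s n + s.countP (fun i : ℕ+ => n < (i : ℕ)) := by
    intro s n
    induction s using Multiset.induction_on with
    | empty => simp [Part.columns]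
    | cons a s ih =>
      simp only [Part.columns, Multiset.map_cons, Multiset.sum_cons, Multiset.countP_cons] at ih ⊢
      rw [ih]
      split_ifs with h <;> omega
  have h2 : ∀ (s : Part) (i : ℕ+), s.countP (fun j : ℕ+ => (i : ℕ) - 1 < (j : ℕ)) =
      s.countP (fun j : ℕ+ => (i : ℕ) < (j : ℕ)) + s.count i := by
    intro s i
    induction s using Multiset.induction_on with
    | empty => simp
    | cons a s ih =>
      simp only [Multiset.count_cons, Multiset.countP_cons, ← PNat.coe_inj] at ih ⊢
      rw [ih]
      have := i.pos
      split_ifs <;> omega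
  have h3 : ∀ n : ℕ, s.countP (fun i : ℕ+ => n < (i : ℕ)) = t.countP (fun i : ℕ+ => n < (i : ℕ)) := by
    intro n
    have := h (n + 1)
    rw [key, key, h n] at this
    omega
  ext i
  have e1 := h2 s i
  have e2 := h2 t i
  rw [h3, h3] at e1
  omega

/-- The kernel of `p ^ n` has dimension `deg p` times the size of the first `n` columns of the
partition at `p`, so these kernels determine the type. This is how types are compared below. -/
theorem type_ext [Fintype F] {V W : Type*} [AddCommGroup V] [Module F[X] V]
    [AddCommGroup W] [Module F[X] W] {μ ν : MultiPart F} (hV : ModuleHasType V μ)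
    (hW : ModuleHasType W ν) (h : ∀ (p : Phi F) n, kerCard V (p.1 ^ n) = kerCard W (p.1 ^ n)) :
    μ = ν := by
  ext1 p
  refine Part.ext_columns fun n => ?_
  have := h p n
  rw [kerCard_of_type hV, kerCard_of_type hW] at this
  have := Nat.pow_right_injective (Fintype.one_lt_card (α := F)) this
  exact Nat.eq_of_mul_eq_mul_left (Irreducible.natDegree_pos p.2.2.1) this

theorem ModuleHasType.unique [Fintype F] {V : Type*} [AddCommGroup V] [Module F[X] V]
    {μ ν : MultiPart F} (hμ : ModuleHasType V μ) (hν : ModuleHasType V ν) : μ = ν :=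
  type_ext hμ hν fun _ _ => rfl

end Types

/-! ### Existence of types from the structure theorem -/

section Existence

variable {F : Type*} [Field F]

theorem ModuleHasType.congr {V W : Type*} [AddCommGroup V] [Module F[X] V] [AddCommGroup W]
    [Module F[X] W] {μ : MultiPart F} (h : ModuleHasType W μ) (e : V ≃ₗ[F[X]] W) :
    ModuleHasType V μ :=
  let ⟨e'⟩ := h
  ⟨e.trans e'⟩

open Classical in
/-- The type with a given finite family of elementary divisors. -/
theorem moduleHasType_pi {ι : Type*} [Fintype ι] (κ : ι → Phi F × ℕ+) :
    ModuleHasType (∀ i, F[X] ⧸ Ideal.span {(κ i).1.1 ^ ((κ i).2 : ℕ)})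
      (∑ i, Finsupp.single (κ i).1 ({(κ i).2} : Part)) := by
  set μ : MultiPart F := ∑ i, Finsupp.single (κ i).1 ({(κ i).2} : Part) with hμ
  have hcount : ∀ x : Phi F × ℕ+, Fintype.card {i // κ i = x} = (μ x.1).count x.2 := by
    intro x
    rw [hμ, Finsupp.finsetSum_apply, Multiset.count_sum', Fintype.card_subtype,
      Finset.card_filter]
    refine Finset.sum_congr rfl fun i _ => ?_
    rw [Finsupp.single_apply]
    by_cases h1 : (κ i).1 = x.1
    · by_cases h2 : (κ i).2 = x.2
      · rw [if_pos (Prod.ext h1 h2), if_pos h1, h2, Multiset.count_singleton_self]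
      · rw [if_neg (fun h => h2 (congrArg Prod.snd h)), if_pos h1,
          Multiset.count_singleton, if_neg (Ne.symm h2)]
    · rw [if_neg (fun h => h1 (congrArg Prod.fst h)), if_neg h1, Multiset.count_zero]
  -- The multiplicity of `x` in `μ` is the size of the fibre of `κ` over `x`, so the index set is
  -- the disjoint union of the fibres.
  let e : DivisorIndex μ ≃ ι :=
    (Equiv.sigmaCongrRight fun x => (Fintype.equivFinOfCardEq (hcount x)).symm).trans
      (Equiv.sigmaFiberEquiv κ)
  have he : ∀ j, κ (e j) = j.1 := fun j =>
    ((Fintype.equivFinOfCardEq (hcount j.1)).symm j.2).2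
  have h1 : (∀ j, F[X] ⧸ Ideal.span {(κ (e j)).1.1 ^ ((κ (e j)).2 : ℕ)}) ≃ₗ[F[X]]
      ∀ j : DivisorIndex μ, F[X] ⧸ Ideal.span {j.1.1.1 ^ (j.1.2 : ℕ)} := by
    refine LinearEquiv.piCongrRight fun j => Submodule.quotEquivOfEq _ _ ?_
    rw [he]
  exact ⟨(LinearEquiv.piCongrLeft F[X]
    (fun i => F[X] ⧸ Ideal.span {(κ i).1.1 ^ ((κ i).2 : ℕ)}) e).symm.trans
    (h1.trans (DirectSum.linearEquivFunOnFintype F[X] _ _).symm)⟩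

/-- Modules of finite length on which `t` acts injectively have a type. -/
theorem exists_moduleHasType {F : Type*} [Field F] {V : Type*} [AddCommGroup V]
    [Module F[X] V] [Module.Finite F[X] V] (ht : Module.IsTorsion F[X] V)
    (hX : ∀ x : V, (X : F[X]) • x = 0 → x = 0) : ∃ μ : MultiPart F, ModuleHasType V μ := by
  classical
  obtain ⟨ι, _, p, hp, e, ⟨f⟩⟩ := Module.equiv_directSum_of_isTorsion ht
  have g : V ≃ₗ[F[X]] ∀ i, F[X] ⧸ Ideal.span {p i ^ e i} :=
    f.trans (DirectSum.linearEquivFunOnFintype F[X] _ _)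
  have hXn : ∀ (n : ℕ) (x : V), (X ^ n : F[X]) • x = 0 → x = 0 := by
    intro n
    induction n with
    | zero => intro x hx; simpa using hx
    | succ n ih =>
      intro x hx
      rw [pow_succ, mul_smul] at hx
      exact hX _ (ih _ hx)
  let r : ι → F[X] := fun i => p i * C (p i).leadingCoeff⁻¹
  have hrm : ∀ i, (r i).Monic := fun i => monic_mul_leadingCoeff_inv (hp i).ne_zero
  have hra : ∀ i, Associated (p i) (r i) := fun i => by
    refine associated_mul_unit_right _ _ (isUnit_C.2 ?_)
    exact (isUnit_iff_ne_zero.2 (inv_ne_zero (leadingCoeff_ne_zero.2 (hp i).ne_zero)))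
  have hri : ∀ i, Irreducible (r i) := fun i => (hra i).irreducible (hp i)
  have hspan : ∀ i, Ideal.span {p i ^ e i} = Ideal.span {r i ^ e i} := fun i =>
    Ideal.span_singleton_eq_span_singleton.2 ((hra i).pow_pow)
  -- If the prime were `X`, the class of `1` in that summand would be killed by a power of `X`. The
  -- structure theorem allows `e i = 0`; such summands are zero and are dropped below.
  have hrX : ∀ i, e i ≠ 0 → r i ≠ X := by
    intro i hi hrX
    have h1 : g.symm (Pi.single i (Ideal.Quotient.mk _ 1)) = 0 := by
      refine hXn (e i) _ ?_
      rw [← map_smul, ← Pi.single_smul]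
      have : (X ^ e i : F[X]) • (Ideal.Quotient.mk (Ideal.span {p i ^ e i}) 1) = 0 := by
        change Ideal.Quotient.mk (Ideal.span {p i ^ e i}) (X ^ e i * 1) = 0
        rw [Ideal.Quotient.eq_zero_iff_mem, mul_one, hspan, hrX]
        exact Ideal.mem_span_singleton_self _
      rw [this, Pi.single_zero, map_zero]
    rw [LinearEquiv.map_eq_zero_iff, Pi.single_eq_zero_iff, Ideal.Quotient.eq_zero_iff_mem,
      Ideal.mem_span_singleton] at h1
    exact (hp i).not_isUnit (isUnit_of_dvd_one ((dvd_pow_self _ hi).trans h1))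
  let κ : {i // e i ≠ 0} → Phi F × ℕ+ := fun i =>
    (⟨r i, hrm i, hri i, hrX i i.2⟩, ⟨e i, Nat.pos_of_ne_zero i.2⟩)
  have h1 : (∀ i, F[X] ⧸ Ideal.span {p i ^ e i}) ≃ₗ[F[X]]
      ∀ i : {i // e i ≠ 0}, F[X] ⧸ Ideal.span {p i.1 ^ e i.1} := by
    refine LinearEquiv.ofBijective
      (LinearMap.pi fun i : {i // e i ≠ 0} => LinearMap.proj i.1) ⟨?_, ?_⟩
    · intro x y hxy
      funext i
      by_cases hi : e i = 0
      · have : Subsingleton (F[X] ⧸ Ideal.span {p i ^ e i}) := by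
          rw [hi, pow_zero, Ideal.span_singleton_one]
          infer_instance
        exact Subsingleton.elim _ _
      · exact congrFun hxy ⟨i, hi⟩
    · intro y
      refine ⟨fun i => if hi : e i ≠ 0 then y ⟨i, hi⟩ else 0, funext fun i => ?_⟩
      exact dif_pos i.2
  have h2 : (∀ i : {i // e i ≠ 0}, F[X] ⧸ Ideal.span {p i.1 ^ e i.1}) ≃ₗ[F[X]]
      ∀ i : {i // e i ≠ 0}, F[X] ⧸ Ideal.span {(κ i).1.1 ^ ((κ i).2 : ℕ)} :=
    LinearEquiv.piCongrRight fun i => Submodule.quotEquivOfEq _ _ (hspan i.1)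
  exact ⟨_, (moduleHasType_pi κ).congr (g.trans (h1.trans h2))⟩

end Existence

/-! ### Types of matrices and the corner description of the modified type -/

section MatrixTypes

variable {F : Type*} [Field F]

/-- The square matrix `N` has type `μ`. -/
def MatrixHasType {n : Type*} [Fintype n] [DecidableEq n] (N : Matrix n n F) (μ : MultiPart F) :
    Prop :=
  ModuleHasType (Module.AEval' (Matrix.toLin' N)) μ

theorem aeval_toLin' {n : Type*} [Fintype n] [DecidableEq n] (N : Matrix n n F) (f : F[X]) :
    aeval (Matrix.toLin' N) f = Matrix.toLin' (aeval N f) :=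
  (aeval_algHom_apply (Matrix.toLinAlgEquiv' : Matrix n n F ≃ₐ[F] _).toAlgHom N f)

theorem kerCard_matrix {n : Type*} [Fintype n] [DecidableEq n] (N : Matrix n n F) (f : F[X]) :
    kerCard (Module.AEval' (Matrix.toLin' N)) f =
      Nat.card {x : n → F // (aeval N f).mulVec x = 0} := by
  refine Nat.card_congr ((Module.AEval'.of (Matrix.toLin' N)).symm.toEquiv.subtypeEquiv
    fun x => ?_)
  rw [← (Module.AEval'.of (Matrix.toLin' N)).symm.map_eq_zero_iff, Module.AEval.of_symm_smul,
    aeval_toLin']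
  rfl

theorem MatrixHasType.unique [Fintype F] {n : Type*} [Fintype n] [DecidableEq n]
    {N : Matrix n n F} {μ ν : MultiPart F} (hμ : MatrixHasType N μ) (hν : MatrixHasType N ν) :
    μ = ν :=
  ModuleHasType.unique hμ hν

theorem MatrixHasType.card_eq [Fintype F] {n : Type*} [Fintype n] [DecidableEq n]
    {N : Matrix n n F} {μ : MultiPart F} (hμ : MatrixHasType N μ) : Fintype.card n = μ.size := by
  have h1 := natCard_of_type hμ
  have h2 : Nat.card (Module.AEval' (Matrix.toLin' N)) = Fintype.card F ^ Fintype.card n := by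
    rw [← Nat.card_congr (Module.AEval'.of (Matrix.toLin' N)).toEquiv, Nat.card_eq_fintype_card,
      Fintype.card_fun]
  rw [h2] at h1
  exact Nat.pow_right_injective (Fintype.one_lt_card (α := F)) h1

theorem exists_matrixHasType {n : Type*} [Fintype n] [DecidableEq n] {N : Matrix n n F}
    (hN : IsUnit N) : ∃ μ : MultiPart F, MatrixHasType N μ := by
  refine exists_moduleHasType (Module.AEval.isTorsion_of_finiteDimensional _ _ _) fun x hx => ?_
  have h : N.mulVec ((Module.AEval'.of (Matrix.toLin' N)).symm x) = 0 := by
    have := Module.AEval'.of_symm_X_smul (Matrix.toLin' N) x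
    rw [hx, map_zero] at this
    exact this.symm
  have h2 := (Matrix.mulVec_injective_of_isUnit hN) (h.trans (Matrix.mulVec_zero N).symm)
  exact (LinearEquiv.map_eq_zero_iff _).1 h2

/-- `X` is coprime to every elementary divisor, hence acts injectively. This makes a matrix that has
a type invertible. -/
theorem kerCard_X_of_type [Fintype F] {V : Type*} [AddCommGroup V] [Module F[X] V]
    {μ : MultiPart F} (hV : ModuleHasType V μ) : kerCard V (X : F[X]) = 1 := by
  obtain ⟨e⟩ := hV
  rw [kerCard_congr (e.trans (DirectSum.linearEquivFunOnFintype F[X] _ _)), kerCard_pi]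
  refine Finset.prod_eq_one fun j _ => ?_
  rw [kerCard_quotient (pow_ne_zero _ j.1.1.2.2.1.ne_zero)]
  have hc : IsCoprime j.1.1.1 (X : F[X]) := by
    refine (Irreducible.coprime_iff_not_dvd j.1.1.2.2.1).2 fun hd => j.1.1.2.2.2 ?_
    exact eq_of_monic_of_associated j.1.1.2.1 monic_X
      (j.1.1.2.2.1.associated_of_dvd irreducible_X hd)
  have : Ideal.span {j.1.1.1 ^ (j.1.2 : ℕ)} ⊔ Ideal.span {(X : F[X])} = ⊤ := by
    rw [← Ideal.isCoprime_iff_sup_eq, Ideal.isCoprime_span_singleton_iff]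
    exact hc.pow_left
  rw [this]
  exact Nat.card_unique

theorem MatrixHasType.isUnit [Fintype F] {n : Type*} [Fintype n] [DecidableEq n]
    {N : Matrix n n F} {μ : MultiPart F} (hμ : MatrixHasType N μ) : IsUnit N := by
  have h := kerCard_X_of_type hμ
  rw [kerCard_matrix, aeval_X] at h
  have h2 := (Nat.card_eq_one_iff_unique.1 h).1
  rw [← Matrix.mulVec_injective_iff_isUnit]
  refine (injective_iff_map_eq_zero N.mulVecLin).2 fun x hx => ?_
  exact congrArg Subtype.val (h2.elim ⟨x, hx⟩ ⟨0, Matrix.mulVec_zero N⟩)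

/-- Every multipartition is the type of some matrix. -/
theorem exists_matrix_of_type [Fintype F] (μ : MultiPart F) :
    ∃ N : Matrix (Fin μ.size) (Fin μ.size) F, MatrixHasType N μ := by
  let V := ∀ j : DivisorIndex μ, F[X] ⧸ Ideal.span {j.1.1.1 ^ (j.1.2 : ℕ)}
  have hV : ModuleHasType V μ := ⟨(DirectSum.linearEquivFunOnFintype F[X] _ _).symm⟩
  have : ∀ j : DivisorIndex μ, Module.Finite F (F[X] ⧸ Ideal.span {j.1.1.1 ^ (j.1.2 : ℕ)}) :=
    fun j => (AdjoinRoot.powerBasis (pow_ne_zero _ j.1.1.2.2.1.ne_zero)).finite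
  have hf : Module.finrank F V = μ.size := by
    have h := natCard_of_type hV
    rw [Module.natCard_eq_pow_finrank (K := F), Nat.card_eq_fintype_card] at h
    exact Nat.pow_right_injective (Fintype.one_lt_card (α := F)) h
  let e : V ≃ₗ[F] (Fin μ.size → F) := (Module.finBasisOfFinrankEq F V hf).equivFun
  let φ : V →ₗ[F] V := (LinearMap.lsmul F[X] V X).restrictScalars F
  refine ⟨LinearMap.toMatrix' (e.toLinearMap ∘ₗ φ ∘ₗ e.symm.toLinearMap), ?_⟩
  refine hV.congr (LinearEquiv.ofAEval _ e.symm fun m => ?_)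
  rw [Matrix.toLin'_toMatrix']
  exact e.symm_apply_apply _

/-- Matrices of the same type are conjugate. -/
theorem MatrixHasType.conj {n : Type*} [Fintype n] [DecidableEq n] {N N' : Matrix n n F}
    {μ : MultiPart F} (h : MatrixHasType N μ) (h' : MatrixHasType N' μ) :
    ∃ x y : Matrix n n F, x * y = 1 ∧ y * x = 1 ∧ x * N = N' * x := by
  obtain ⟨e⟩ := h
  obtain ⟨e'⟩ := h'
  let φ := e.trans e'.symm
  let ψ : (n → F) ≃ₗ[F] (n → F) := (Module.AEval'.of (Matrix.toLin' N)).trans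
    ((φ.restrictScalars F).trans (Module.AEval'.of (Matrix.toLin' N')).symm)
  refine ⟨LinearMap.toMatrix' ψ.toLinearMap, LinearMap.toMatrix' ψ.symm.toLinearMap, ?_, ?_, ?_⟩
  · rw [← LinearMap.toMatrix'_comp, LinearEquiv.comp_symm, LinearMap.toMatrix'_id]
  · rw [← LinearMap.toMatrix'_comp, LinearEquiv.symm_comp, LinearMap.toMatrix'_id]
  · apply Matrix.toLin'.injective
    rw [Matrix.toLin'_mul, Matrix.toLin'_mul, Matrix.toLin'_toMatrix']
    refine LinearMap.ext fun x => ?_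
    change (Module.AEval'.of (Matrix.toLin' N')).symm
      (φ (Module.AEval'.of (Matrix.toLin' N) (Matrix.toLin' N x))) =
      Matrix.toLin' N' ((Module.AEval'.of (Matrix.toLin' N')).symm
        (φ (Module.AEval'.of (Matrix.toLin' N) x)))
    rw [← Module.AEval'.X_smul_of, map_smul, Module.AEval'.of_symm_X_smul]

/-- For each part `i`, `min (i - 1) n + min i 1 = min i (n + 1)`; parts equal to `1` disappear but
contribute `0` to the first term. -/
theorem Part.columns_removeColumn (s : Part) (n : ℕ) :
    Part.columns s.removeColumn n + Part.columns s 1 = Part.columns s (n + 1) := by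
  induction s using Multiset.induction_on with
  | empty => simp [Part.columns, Part.removeColumn]
  | cons a s ih =>
    have hcons : ∀ (b : ℕ+) (t : Part) (k : ℕ),
        Part.columns (b ::ₘ t) k = min (b : ℕ) k + Part.columns t k := fun b t k => by
      rw [Part.columns, Multiset.map_cons, Multiset.sum_cons, Part.columns]
    have ha := a.pos
    rw [hcons, hcons]
    by_cases h : 1 < a
    · have h1 : ((a - 1 : ℕ+) : ℕ) = a - 1 := by rw [PNat.sub_coe, if_pos h]; rfl
      have h2 : Part.removeColumn (a ::ₘ s) = (a - 1) ::ₘ Part.removeColumn s := by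
        rw [Part.removeColumn, Multiset.filter_cons_of_pos _ h, Multiset.map_cons,
          Part.removeColumn]
      rw [h2, hcons, h1]
      rw [← PNat.coe_lt_coe, PNat.one_coe] at h
      omega
    · have h2 : Part.removeColumn (a ::ₘ s) = Part.removeColumn s := by
        rw [Part.removeColumn, Multiset.filter_cons_of_neg _ h, Part.removeColumn]
      have h1 : (a : ℕ) = 1 := by
        rw [← PNat.coe_lt_coe, PNat.one_coe] at h
        omega
      rw [h2]
      omega

variable {m l : Type*} [Fintype m] [DecidableEq m] [Fintype l] [DecidableEq l]

theorem mul_aeval_of_mul_eq {N : Matrix m m F} {N' : Matrix l l F} {u : Matrix m l F}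
    (h : u * N' = N * u) (f : F[X]) : u * aeval N' f = aeval N f * u := by
  induction f using Polynomial.induction_on' with
  | add f g hf hg => rw [map_add, map_add, Matrix.mul_add, Matrix.add_mul, hf, hg]
  | monomial n a =>
    rw [aeval_monomial, aeval_monomial, ← Algebra.smul_def, ← Algebra.smul_def,
      Matrix.mul_smul, Matrix.smul_mul]
    congr 1
    induction n with
    | zero => rw [pow_zero, pow_zero, Matrix.mul_one, Matrix.one_mul]
    | succ n ih => rw [pow_succ, ← Matrix.mul_assoc, ih, Matrix.mul_assoc, h, ← Matrix.mul_assoc,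
        ← pow_succ]

theorem mul_pow_mul (u : Matrix m l F) (v : Matrix l m F) (n : ℕ) :
    u * (v * u) ^ n * v = (u * v) ^ (n + 1) := by
  induction n with
  | zero => rw [pow_zero, Matrix.mul_one, zero_add, pow_one]
  | succ n ih => rw [pow_succ _ (n + 1), ← ih, pow_succ]; simp only [Matrix.mul_assoc]

/-- The map `u` intertwines `1 + v * u` with `1 + u * v`, so it embeds one kernel in the other. By
the Bézout relation every `x` killed by `f (1 + u * v)` lies in the image of `u * v`, so the
embedding is onto. -/
theorem kerCard_corner_of_isCoprime {u : Matrix m l F} {v : Matrix l m F} {L : Matrix l m F}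
    (hL : L * u = 1) {f : F[X]} (hf : IsCoprime f (X - C 1)) :
    kerCard (Module.AEval' (Matrix.toLin' (1 + v * u))) f =
      kerCard (Module.AEval' (Matrix.toLin' (1 + u * v))) f := by
  rw [kerCard_matrix, kerCard_matrix]
  have hu : u * (1 + v * u) = (1 + u * v) * u := by
    rw [Matrix.mul_add, Matrix.add_mul, Matrix.mul_one, Matrix.one_mul, Matrix.mul_assoc]
  have hc := mul_aeval_of_mul_eq hu f
  have hcan : ∀ y : l → F, u.mulVec y = 0 → y = 0 := fun y hy => by
    have := congrArg L.mulVec hy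
    rwa [Matrix.mulVec_mulVec, hL, Matrix.one_mulVec, Matrix.mulVec_zero] at this
  obtain ⟨a, b, hab⟩ := hf
  refine Nat.card_congr (Equiv.ofBijective (fun y => ⟨u.mulVec y.1, ?_⟩) ⟨?_, ?_⟩)
  · rw [Matrix.mulVec_mulVec, ← hc, ← Matrix.mulVec_mulVec, y.2, Matrix.mulVec_zero]
  · intro y y' h
    have h := congrArg Subtype.val h
    refine Subtype.ext (sub_eq_zero.1 (hcan _ ?_))
    rw [Matrix.mulVec_sub]
    exact sub_eq_zero.2 h
  · rintro ⟨x, hx⟩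
    have h1 : u.mulVec ((v * aeval (1 + u * v) b).mulVec x) = x := by
      have h2 := congrArg (fun g => (aeval (1 + u * v) g).mulVec x) hab
      simp only [map_add, map_mul, map_sub, aeval_X, map_one, Matrix.add_mulVec,
        Matrix.one_mulVec] at h2
      rw [← Matrix.mulVec_mulVec, hx, Matrix.mulVec_zero, zero_add, add_sub_cancel_left] at h2
      rw [Matrix.mulVec_mulVec, ← Matrix.mul_assoc]
      have h3 : u * v * aeval (1 + u * v) b = aeval (1 + u * v) b * (u * v) := by
        refine (mul_aeval_of_mul_eq (N := 1 + u * v) (N' := 1 + u * v) ?_ b)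
        rw [Matrix.mul_add, Matrix.add_mul, Matrix.mul_one, Matrix.one_mul]
      rw [h3]
      exact h2
    refine ⟨⟨(v * aeval (1 + u * v) b).mulVec x, hcan _ ?_⟩, Subtype.ext h1⟩
    rw [Matrix.mulVec_mulVec, hc, ← Matrix.mulVec_mulVec, h1, hx]

/-- Since `(u * v) ^ (n + 1) = u * (v * u) ^ n * v` and `u` is injective, `v` maps the kernel of `(u
* v) ^ (n + 1)` onto that of `(v * u) ^ n`, with kernel that of `u * v`. The section `R` splits
this. Dividing by the kernel of `u * v` is what deletes the first column. -/
theorem kerCard_corner_unipotent {u : Matrix m l F} {v : Matrix l m F} {L : Matrix l m F}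
    {R : Matrix m l F} (hL : L * u = 1) (hR : v * R = 1) (n : ℕ) :
    kerCard (Module.AEval' (Matrix.toLin' (1 + v * u))) ((X - C 1 : F[X]) ^ n) *
      kerCard (Module.AEval' (Matrix.toLin' (1 + u * v))) ((X - C 1 : F[X]) ^ 1) =
      kerCard (Module.AEval' (Matrix.toLin' (1 + u * v))) ((X - C 1 : F[X]) ^ (n + 1)) := by
  simp only [kerCard_matrix, map_pow, map_sub, aeval_X, map_one, add_sub_cancel_left, pow_one]
  rw [← Nat.card_prod]
  have hcan : ∀ y : l → F, u.mulVec y = 0 → y = 0 := fun y hy => by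
    have := congrArg L.mulVec hy
    rwa [Matrix.mulVec_mulVec, hL, Matrix.one_mulVec, Matrix.mulVec_zero] at this
  have hker : ∀ x : m → F, (u * v).mulVec x = 0 ↔ v.mulVec x = 0 := fun x => by
    rw [← Matrix.mulVec_mulVec]
    exact ⟨hcan _, fun h => by rw [h, Matrix.mulVec_zero]⟩
  have hker' : ∀ x : m → F, ((u * v) ^ (n + 1)).mulVec x = 0 ↔
      ((v * u) ^ n).mulVec (v.mulVec x) = 0 := fun x => by
    rw [← mul_pow_mul, Matrix.mul_assoc, ← Matrix.mulVec_mulVec, ← Matrix.mulVec_mulVec]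
    exact ⟨hcan _, fun h => by rw [h, Matrix.mulVec_zero]⟩
  have hvR : ∀ y : l → F, v.mulVec (R.mulVec y) = y := fun y => by
    rw [Matrix.mulVec_mulVec, hR, Matrix.one_mulVec]
  refine Nat.card_congr
    ⟨fun z => ⟨R.mulVec z.1.1 + z.2.1, ?_⟩,
     fun x => (⟨v.mulVec x.1, (hker' _).1 x.2⟩, ⟨x.1 - R.mulVec (v.mulVec x.1), ?_⟩), ?_, ?_⟩
  · rw [hker', Matrix.mulVec_add, hvR, (hker _).1 z.2.2, add_zero]
    exact z.1.2
  · rw [hker, Matrix.mulVec_sub, hvR, sub_self]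
  · rintro ⟨⟨y, hy⟩, ⟨x, hx⟩⟩
    have : v.mulVec (R.mulVec y + x) = y := by
      rw [Matrix.mulVec_add, hvR, (hker _).1 hx, add_zero]
    simp only [this, add_sub_cancel_left]
  · rintro ⟨x, hx⟩
    exact Subtype.ext (add_sub_cancel _ _)

/-- The modified type of `1 + u v` is the type of `1 + v u` when `u` is injective and `v` is
surjective: both describe the restriction of `1 + u v` to the image of `u v`. -/
theorem MatrixHasType.corner [Fintype F] {u : Matrix m l F} {v : Matrix l m F}
    {L : Matrix l m F} {R : Matrix m l F} (hL : L * u = 1) (hR : v * R = 1) {μ : MultiPart F}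
    (h : MatrixHasType (1 + u * v) μ) : MatrixHasType (1 + v * u) μ.modified := by
  classical
  -- The corner has the same determinant, so it has some type; that type is then identified through
  -- its kernels.
  have hunit : IsUnit (1 + v * u) := by
    rw [Matrix.isUnit_iff_isUnit_det, Matrix.det_one_add_mul_comm,
      ← Matrix.isUnit_iff_isUnit_det]
    exact h.isUnit
  obtain ⟨μ', h'⟩ := exists_matrixHasType hunit
  suffices hμ : μ' = μ.modified from hμ ▸ h'
  have hq := Fintype.one_lt_card (α := F)
  ext1 p
  refine Part.ext_columns fun n => ?_
  rw [MultiPart.modified, Finsupp.coe_update]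
  by_cases hp : p = phiOne F
  · subst hp
    rw [Function.update_self]
    have h1 := kerCard_corner_unipotent hL hR n
    have key : ∀ n, (X - C 1 : F[X]) ^ n = (phiOne F).1 ^ n := fun _ => rfl
    rw [key, key, key, kerCard_of_type h, kerCard_of_type h, kerCard_of_type h', ← pow_add] at h1
    have h2 := Nat.pow_right_injective hq h1
    have h3 : (phiOne F).1.natDegree = 1 := natDegree_X_sub_C 1
    rw [h3, one_mul, one_mul, one_mul] at h2
    have h4 := Part.columns_removeColumn (μ (phiOne F)) n
    omega
  · rw [Function.update_of_ne hp]
    have hc : IsCoprime (p.1 ^ n) (X - C 1) := by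
      refine IsCoprime.pow_left ((Irreducible.coprime_iff_not_dvd p.2.2.1).2 fun hd => hp ?_)
      exact Subtype.ext (eq_of_monic_of_associated p.2.1 (monic_X_sub_C 1)
        (p.2.2.1.associated_of_dvd (irreducible_X_sub_C 1) hd))
    have h1 := kerCard_corner_of_isCoprime (v := v) hL hc
    rw [kerCard_of_type h, kerCard_of_type h'] at h1
    exact Nat.eq_of_mul_eq_mul_left (Irreducible.natDegree_pos p.2.2.1)
      (Nat.pow_right_injective hq h1)

end MatrixTypes

/-! ### Rank factorizations and modified types -/

section RankFactorization

variable {F : Type*} [Field F] {m n S R : Type*} [Fintype m] [DecidableEq m] [Fintype n]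
  [DecidableEq n] [Fintype S] [DecidableEq S] [Fintype R] [DecidableEq R]

/-- The matrix `u` is injective. -/
def HasLeftInv (u : Matrix m S F) : Prop := ∃ L : Matrix S m F, L * u = 1

/-- The matrix `v` is surjective. -/
def HasRightInv (v : Matrix R m F) : Prop := ∃ L : Matrix m R F, v * L = 1

theorem HasLeftInv.transpose {u : Matrix m S F} (h : HasLeftInv u) : HasRightInv u.transpose :=
  let ⟨L, hL⟩ := h
  ⟨L.transpose, by rw [← Matrix.transpose_mul, hL, Matrix.transpose_one]⟩

theorem HasRightInv.transpose {v : Matrix R m F} (h : HasRightInv v) : HasLeftInv v.transpose :=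
  let ⟨L, hL⟩ := h
  ⟨L.transpose, by rw [← Matrix.transpose_mul, hL, Matrix.transpose_one]⟩

theorem HasLeftInv.mul {u : Matrix m S F} {w : Matrix S R F} (hu : HasLeftInv u)
    (hw : HasLeftInv w) : HasLeftInv (u * w) := by
  obtain ⟨L, hL⟩ := hu
  obtain ⟨L', hL'⟩ := hw
  exact ⟨L' * L, by rw [Matrix.mul_assoc, ← Matrix.mul_assoc L, hL, Matrix.one_mul, hL']⟩

theorem HasRightInv.mul {v : Matrix S R F} {w : Matrix R m F} (hv : HasRightInv v)
    (hw : HasRightInv w) : HasRightInv (v * w) := by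
  obtain ⟨L, hL⟩ := hv
  obtain ⟨L', hL'⟩ := hw
  exact ⟨L' * L, by rw [Matrix.mul_assoc, ← Matrix.mul_assoc w, hL', Matrix.one_mul, hL]⟩

theorem HasLeftInv.cancel {u : Matrix m S F} (hu : HasLeftInv u) {x y : Matrix S R F}
    (h : u * x = u * y) : x = y := by
  obtain ⟨L, hL⟩ := hu
  have := congrArg (L * ·) h
  simpa only [← Matrix.mul_assoc, hL, Matrix.one_mul] using this

theorem HasRightInv.cancel {v : Matrix R m F} (hv : HasRightInv v) {x y : Matrix S R F}
    (h : x * v = y * v) : x = y := by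
  obtain ⟨L, hL⟩ := hv
  have := congrArg (· * L) h
  simpa only [Matrix.mul_assoc, hL, Matrix.mul_one] using this

theorem hasLeftInv_iff {u : Matrix m S F} :
    HasLeftInv u ↔ ∀ y : S → F, u.mulVec y = 0 → y = 0 := by
  classical
  constructor
  · rintro ⟨L, hL⟩ y hy
    have := congrArg L.mulVec hy
    rwa [Matrix.mulVec_mulVec, hL, Matrix.one_mulVec, Matrix.mulVec_zero] at this
  · intro h
    have hk : LinearMap.ker (Matrix.toLin' u) = ⊥ := LinearMap.ker_eq_bot'.2 h
    obtain ⟨g, hg⟩ := (Matrix.toLin' u).exists_leftInverse_of_injective hk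
    refine ⟨LinearMap.toMatrix' g, Matrix.toLin'.injective ?_⟩
    rw [Matrix.toLin'_mul, Matrix.toLin'_toMatrix', hg, Matrix.toLin'_one]

theorem exists_rank_factorization (C : Matrix S R F) :
    ∃ (l : ℕ) (u : Matrix S (Fin l) F) (w : Matrix (Fin l) R F),
      HasLeftInv u ∧ HasRightInv w ∧ C = u * w := by
  let φ := Matrix.toLin' C
  let e : LinearMap.range φ ≃ₗ[F] (Fin (Module.finrank F (LinearMap.range φ)) → F) :=
    (Module.finBasis F (LinearMap.range φ)).equivFun
  let f : (Fin (Module.finrank F (LinearMap.range φ)) → F) →ₗ[F] (S → F) :=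
    (LinearMap.range φ).subtype ∘ₗ e.symm.toLinearMap
  let g : (R → F) →ₗ[F] (Fin (Module.finrank F (LinearMap.range φ)) → F) :=
    e.toLinearMap ∘ₗ φ.rangeRestrict
  have hf : LinearMap.ker f = ⊥ := LinearMap.ker_eq_bot.2
    (Subtype.val_injective.comp e.symm.injective)
  have hg : LinearMap.range g = ⊤ := LinearMap.range_eq_top.2
    (e.surjective.comp φ.surjective_rangeRestrict)
  obtain ⟨f', hf'⟩ := f.exists_leftInverse_of_injective hf
  obtain ⟨g', hg'⟩ := g.exists_rightInverse_of_surjective hg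
  refine ⟨_, LinearMap.toMatrix' f, LinearMap.toMatrix' g, ⟨LinearMap.toMatrix' f', ?_⟩,
    ⟨LinearMap.toMatrix' g', ?_⟩, ?_⟩
  · rw [← LinearMap.toMatrix'_comp, hf', LinearMap.toMatrix'_id]
  · rw [← LinearMap.toMatrix'_comp, hg', LinearMap.toMatrix'_id]
  · rw [← LinearMap.toMatrix'_comp]
    have : f ∘ₗ g = φ := by
      ext1 x
      refine LinearMap.ext fun y => ?_
      simp [f, g]
    rw [this, LinearMap.toMatrix'_toLin']

/-- For `α = α₁ α₂` a rank factorization, `1 + α₂ B α₁` has type `μ`. For `B = 1` this says that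
`1 + α` has modified type `μ`. -/
def IsClass (α : Matrix S R F) (B : Matrix R S F) (μ : MultiPart F) : Prop :=
  ∃ (α₁ : Matrix S (Fin μ.size) F) (α₂ : Matrix (Fin μ.size) R F),
    HasLeftInv α₁ ∧ HasRightInv α₂ ∧ α = α₁ * α₂ ∧ MatrixHasType (1 + α₂ * B * α₁) μ

theorem hasModifiedType_iff [Fintype F] {m : ℕ} (g : GL (Fin m) F) (μ : MultiPart F) :
    HasModifiedType g μ ↔ IsClass ((g : Matrix (Fin m) (Fin m) F) - 1) 1 μ := by
  constructor
  · rintro ⟨μ₀, h, rfl⟩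
    obtain ⟨l, u, v, ⟨L, hL⟩, ⟨R, hR⟩, huv⟩ :=
      exists_rank_factorization ((g : Matrix (Fin m) (Fin m) F) - 1)
    have h' : MatrixHasType (1 + u * v) μ₀ := by
      rw [← huv, add_sub_cancel]
      exact h
    have h2 := h'.corner hL hR
    -- The corner is an `l × l` matrix, so the size of the modified type is the rank of `g - 1`.
    have hl : l = μ₀.modified.size := by simpa using h2.card_eq
    subst hl
    exact ⟨u, v, ⟨L, hL⟩, ⟨R, hR⟩, huv, by rwa [Matrix.mul_one]⟩
  · rintro ⟨u, v, ⟨L, hL⟩, ⟨R, hR⟩, huv, h⟩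
    obtain ⟨μ₀, h₀⟩ := exists_matrixHasType g.isUnit
    refine ⟨μ₀, h₀, ?_⟩
    rw [← add_sub_cancel 1 (g : Matrix (Fin m) (Fin m) F), huv] at h₀
    rw [Matrix.mul_one] at h
    exact (h₀.corner hL hR).unique h

/-- Rank factorizations of `u * α * v` and of `α` correspond, because the left factor of the former
has image inside that of `u` and the right factor passes through `v`. The corners agree: `γ₂ * γ₁ =
α₂ * (v * u) * α₁`. Thus the modified type of `u * α * v` depends only on `α` and `v * u`. -/
theorem isClass_mul_iff {u : Matrix m S F} {v : Matrix R m F} (hu : HasLeftInv u)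
    (hv : HasRightInv v) (α : Matrix S R F) (μ : MultiPart F) :
    IsClass (u * α * v) 1 μ ↔ IsClass α (v * u) μ := by
  constructor
  · rintro ⟨γ₁, γ₂, ⟨L₁, h₁⟩, ⟨R₂, h₂⟩, hγ, h⟩
    obtain ⟨L, hL⟩ := hu
    obtain ⟨R', hR⟩ := hv
    have e1 : u * (L * γ₁) = γ₁ := by
      have : γ₁ = u * α * v * R₂ := by rw [hγ, Matrix.mul_assoc, h₂, Matrix.mul_one]
      rw [this]
      simp only [Matrix.mul_assoc]
      rw [← Matrix.mul_assoc L u, hL, Matrix.one_mul]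
    have e2 : γ₂ * R' * v = γ₂ := by
      have : γ₂ = L₁ * (u * α * v) := by rw [hγ, ← Matrix.mul_assoc, h₁, Matrix.one_mul]
      rw [this]
      simp only [Matrix.mul_assoc]
      rw [← Matrix.mul_assoc v, hR, Matrix.one_mul]
    refine ⟨L * γ₁, γ₂ * R', ⟨L₁ * u, by rw [Matrix.mul_assoc, e1, h₁]⟩,
      ⟨v * R₂, by rw [← Matrix.mul_assoc, e2, h₂]⟩, ?_, ?_⟩
    · calc α = (L * u) * α * (v * R') := by rw [hL, hR, Matrix.one_mul, Matrix.mul_one]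
        _ = L * (u * α * v) * R' := by simp only [Matrix.mul_assoc]
        _ = L * γ₁ * (γ₂ * R') := by rw [hγ]; simp only [Matrix.mul_assoc]
    · have : γ₂ * R' * (v * u) * (L * γ₁) = γ₂ * γ₁ := by
        rw [← Matrix.mul_assoc (γ₂ * R'), e2, Matrix.mul_assoc, e1]
      rw [Matrix.mul_one] at h
      rwa [this]
  · rintro ⟨α₁, α₂, h₁, h₂, hα, h⟩
    refine ⟨u * α₁, α₂ * v, hu.mul h₁, h₂.mul hv, ?_, ?_⟩
    · rw [hα]; simp only [Matrix.mul_assoc]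
    · rw [Matrix.mul_one]
      simpa only [Matrix.mul_assoc] using h

/-- Matrices of the same modified type have rank factorizations with the same corner. -/
theorem IsClass.exists_corner {c : Matrix m m F} {μ : MultiPart F} (hc : IsClass c 1 μ)
    {A : Matrix (Fin μ.size) (Fin μ.size) F} (hA : MatrixHasType (1 + A) μ) :
    ∃ (u : Matrix m (Fin μ.size) F) (v : Matrix (Fin μ.size) m F),
      HasLeftInv u ∧ HasRightInv v ∧ c = u * v ∧ v * u = A := by
  obtain ⟨u, v, hu, hv, rfl, h⟩ := hc
  rw [Matrix.mul_one] at h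
  obtain ⟨x, y, hxy, hyx, hx⟩ := h.conj hA
  refine ⟨u * y, x * v, hu.mul ⟨x, hxy⟩, HasRightInv.mul ⟨y, hxy⟩ hv, ?_, ?_⟩
  · rw [Matrix.mul_assoc, ← Matrix.mul_assoc y, hyx, Matrix.one_mul]
  · rw [Matrix.mul_add, Matrix.add_mul, Matrix.mul_one, Matrix.one_mul, add_right_inj] at hx
    calc x * v * (u * y) = x * (v * u) * y := by simp only [Matrix.mul_assoc]
      _ = A := by rw [hx, Matrix.mul_assoc, hxy, Matrix.mul_one]

end RankFactorization

/-! ### Counting pairs of an injective and a surjective matrix -/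

section PairCount

variable {F : Type*} [Field F] {m S R : Type*} [Fintype m] [DecidableEq m]
  [Fintype S] [DecidableEq S] [Fintype R] [DecidableEq R]

/-- The number of pairs of an injective `u` and a surjective `v` with `v u = B` and `u M v = c`. -/
def pairCount (M : Matrix S R F) (B : Matrix R S F) (c : Matrix m m F) : ℕ :=
  Nat.card {p : Matrix m S F × Matrix R m F //
    HasLeftInv p.1 ∧ HasRightInv p.2 ∧ p.2 * p.1 = B ∧ p.1 * M * p.2 = c}

theorem pairCount_transpose (M : Matrix S R F) (B : Matrix R S F) (c : Matrix m m F) :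
    pairCount M.transpose B.transpose c.transpose = pairCount M B c := by
  refine Nat.card_congr ⟨fun p => ⟨(p.1.2.transpose, p.1.1.transpose), ?_⟩,
    fun p => ⟨(p.1.2.transpose, p.1.1.transpose), ?_⟩, fun p => ?_, fun p => ?_⟩
  · obtain ⟨hu, hv, hB, hM⟩ := p.2
    refine ⟨hv.transpose, hu.transpose, ?_, ?_⟩
    · rw [← Matrix.transpose_mul, hB, Matrix.transpose_transpose]
    · refine Matrix.transpose_injective (Eq.trans ?_ hM)
      rw [Matrix.transpose_mul, Matrix.transpose_mul, Matrix.transpose_transpose,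
        Matrix.transpose_transpose, Matrix.mul_assoc]
  · obtain ⟨hu, hv, hB, hM⟩ := p.2
    refine ⟨hv.transpose, hu.transpose, ?_, ?_⟩
    · rw [← Matrix.transpose_mul, hB]
    · rw [← Matrix.transpose_mul, ← Matrix.transpose_mul, ← Matrix.mul_assoc, hM]
  · simp
  · simp

/-- Change of basis in the middle space, used to bring a zero row of `M` into last position. -/
theorem pairCount_congr {S' : Type*} [Fintype S'] [DecidableEq S'] {P : Matrix S' S F}
    {Q : Matrix S S' F} (hPQ : P * Q = 1) (hQP : Q * P = 1) (M : Matrix S R F)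
    (B : Matrix R S F) (c : Matrix m m F) :
    pairCount (P * M) (B * Q) c = pairCount M B c := by
  refine Nat.card_congr ⟨fun p => ⟨(p.1.1 * P, p.1.2), ?_⟩,
    fun p => ⟨(p.1.1 * Q, p.1.2), ?_⟩, fun p => ?_, fun p => ?_⟩
  · obtain ⟨hu, hv, hB, hM⟩ := p.2
    refine ⟨hu.mul ⟨Q, hQP⟩, hv, ?_, ?_⟩
    · rw [← Matrix.mul_assoc, hB, Matrix.mul_assoc, hQP, Matrix.mul_one]
    · refine Eq.trans ?_ hM
      simp only [Matrix.mul_assoc]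
  · obtain ⟨hu, hv, hB, hM⟩ := p.2
    refine ⟨hu.mul ⟨P, hPQ⟩, hv, ?_, ?_⟩
    · rw [← Matrix.mul_assoc, hB]
    · refine Eq.trans ?_ hM
      rw [Matrix.mul_assoc p.1.1 Q, ← Matrix.mul_assoc Q, hQP, Matrix.one_mul]
  · refine Subtype.ext (Prod.ext ?_ rfl)
    change p.1.1 * P * Q = p.1.1
    rw [Matrix.mul_assoc, hPQ, Matrix.mul_one]
  · refine Subtype.ext (Prod.ext ?_ rfl)
    change p.1.1 * Q * P = p.1.1
    rw [Matrix.mul_assoc, hQP, Matrix.mul_one]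

theorem natCard_fiber [Fintype F] {v : Matrix R m F} (hv : HasRightInv v) (b : R → F) :
    Nat.card {w : m → F // v.mulVec w = b} * Fintype.card F ^ Fintype.card R =
      Fintype.card F ^ Fintype.card m := by
  obtain ⟨L, hL⟩ := hv
  have hvL : ∀ y : R → F, v.mulVec (L.mulVec y) = y := fun y => by
    rw [Matrix.mulVec_mulVec, hL, Matrix.one_mulVec]
  have e : {w : m → F // v.mulVec w = b} × (R → F) ≃ (m → F) :=
    ⟨fun z => z.1.1 + L.mulVec (z.2 - b),
     fun w => (⟨w + L.mulVec (b - v.mulVec w), by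
      rw [Matrix.mulVec_add, hvL, add_sub_cancel]⟩, v.mulVec w),
     fun z => by
      obtain ⟨⟨w, hw⟩, y⟩ := z
      have h1 : v.mulVec (w + L.mulVec (y - b)) = y := by
        rw [Matrix.mulVec_add, hvL, hw, add_sub_cancel]
      refine Prod.ext (Subtype.ext ?_) h1
      change w + L.mulVec (y - b) + L.mulVec (b - v.mulVec (w + L.mulVec (y - b))) = w
      rw [h1, add_assoc, ← Matrix.mulVec_add, sub_add_sub_cancel, sub_self, Matrix.mulVec_zero,
        add_zero],
     fun w => by
      change w + L.mulVec (b - v.mulVec w) + L.mulVec (v.mulVec w - b) = w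
      rw [add_assoc, ← Matrix.mulVec_add, sub_add_sub_cancel, sub_self, Matrix.mulVec_zero,
        add_zero]⟩
  have := Nat.card_congr e
  rwa [Nat.card_prod, Nat.card_eq_fintype_card (α := R → F), Fintype.card_fun,
    Nat.card_eq_fintype_card (α := m → F), Fintype.card_fun] at this

/-- The number of vectors with prescribed image under `v` which extend the independent columns
of `u`. -/
theorem natCard_extensions [Fintype F] {u : Matrix m S F} {v : Matrix R m F}
    (hu : HasLeftInv u) (hv : HasRightInv v) (b : R → F) :
    (Nat.card {w : m → F // v.mulVec w = b ∧ ∀ y, u.mulVec y ≠ w} : ℚ) =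
      (Fintype.card F : ℚ) ^ Fintype.card m / (Fintype.card F : ℚ) ^ Fintype.card R -
        Nat.card {y : S → F // (v * u).mulVec y = b} := by
  classical
  have hq : (Fintype.card F : ℚ) ^ Fintype.card R ≠ 0 :=
    pow_ne_zero _ (Nat.cast_ne_zero.2 Fintype.card_ne_zero)
  have h1 := natCard_fiber hv b
  -- The fibre splits according to whether `w` lies in the image of `u`. The excluded part is in
  -- bijection with the solutions of `(v * u) y = b`, so its size depends only on the product `v *
  -- u`.
  have h2 : Nat.card {w : m → F // v.mulVec w = b} =
      Nat.card {w : m → F // v.mulVec w = b ∧ ∀ y, u.mulVec y ≠ w} +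
        Nat.card {y : S → F // (v * u).mulVec y = b} := by
    rw [← Nat.card_sum]
    refine Nat.card_congr ((Equiv.sumCompl fun w : {w : m → F // v.mulVec w = b} =>
      ∀ y, u.mulVec y ≠ w.1).symm.trans (Equiv.sumCongr ?_ ?_))
    · exact Equiv.subtypeSubtypeEquivSubtypeInter _ (fun w : m → F => ∀ y, u.mulVec y ≠ w)
    · refine (Equiv.ofBijective (fun y : {y : S → F // (v * u).mulVec y = b} =>
        ⟨⟨u.mulVec y.1, by rw [Matrix.mulVec_mulVec, y.2]⟩, fun h => h y.1 rfl⟩)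
        ⟨fun y y' h => ?_, ?_⟩).symm
      · have h : u.mulVec y.1 = u.mulVec y'.1 := congrArg (fun z => z.1.1) h
        refine Subtype.ext (sub_eq_zero.1 (hasLeftInv_iff.1 hu _ ?_))
        rw [Matrix.mulVec_sub, h, sub_self]
      · rintro ⟨⟨w, hw⟩, h⟩
        push Not at h
        obtain ⟨y, rfl⟩ := h
        exact ⟨⟨y, by rw [← Matrix.mulVec_mulVec, hw]⟩, rfl⟩
  rw [eq_sub_iff_add_eq, eq_div_iff hq]
  rw [h2] at h1
  exact_mod_cast h1

end PairCount

/-! ### Functions that are polynomial in `q ^ m` -/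

section PolynomialCounts

variable {F : Type*} [Field F] [Fintype F]

/-- On the matrices in `𝒞`, the function `N` is a polynomial of degree at most `n - 2 l` in
`q ^ m`, `m` the number of rows. -/
def IsPolynomialCount (𝒞 : ∀ m : ℕ, Matrix (Fin m) (Fin m) F → Prop) (l n : ℕ)
    (N : ∀ m : ℕ, Matrix (Fin m) (Fin m) F → ℚ) : Prop :=
  ∃ f : ℚ[X], (f = 0 ∨ f.natDegree + 2 * l ≤ n) ∧
    ∀ m c, 𝒞 m c → N m c = f.eval ((Fintype.card F : ℚ) ^ m)

variable {𝒞 : ∀ m : ℕ, Matrix (Fin m) (Fin m) F → Prop} {l n : ℕ}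
  {N N' : ∀ m : ℕ, Matrix (Fin m) (Fin m) F → ℚ}

theorem IsPolynomialCount.zero : IsPolynomialCount 𝒞 l n fun _ _ => 0 :=
  ⟨0, Or.inl rfl, fun _ _ _ => eval_zero.symm⟩

theorem IsPolynomialCount.add (h : IsPolynomialCount 𝒞 l n N) (h' : IsPolynomialCount 𝒞 l n N') :
    IsPolynomialCount 𝒞 l n fun m c => N m c + N' m c := by
  obtain ⟨f, hf, hN⟩ := h
  obtain ⟨g, hg, hN'⟩ := h'
  refine ⟨f + g, ?_, fun m c hc => by simp only [eval_add, hN m c hc, hN' m c hc]⟩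
  rcases hf with rfl | hf
  · rwa [zero_add]
  rcases hg with rfl | hg
  · rw [add_zero]
    exact Or.inr hf
  · have := natDegree_add_le f g
    right
    rcases le_max_iff.1 this with h | h <;> omega

theorem IsPolynomialCount.sum {ι : Type*} (s : Finset ι)
    {N : ι → ∀ m : ℕ, Matrix (Fin m) (Fin m) F → ℚ}
    (h : ∀ i ∈ s, IsPolynomialCount 𝒞 l n (N i)) :
    IsPolynomialCount 𝒞 l n fun m c => ∑ i ∈ s, N i m c := by
  classical
  induction s using Finset.induction_on with
  | empty => simpa only [Finset.sum_empty] using IsPolynomialCount.zero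
  | insert a s ha ih =>
    simp only [Finset.sum_insert ha]
    exact (h a (Finset.mem_insert_self a s)).add
      (ih fun i hi => h i (Finset.mem_insert_of_mem hi))

theorem IsPolynomialCount.const_mul (h : IsPolynomialCount 𝒞 l n N) (a : ℚ) :
    IsPolynomialCount 𝒞 l n fun m c => a * N m c := by
  obtain ⟨f, hf, hN⟩ := h
  refine ⟨C a * f, ?_, fun m c hc => by simp only [eval_mul, eval_C, hN m c hc]⟩
  rcases hf with rfl | hf
  · left; rw [mul_zero]
  · right
    have := natDegree_C_mul_le a f
    omega

theorem IsPolynomialCount.mono (h : IsPolynomialCount 𝒞 l n N) {n' : ℕ} (hn : n ≤ n') :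
    IsPolynomialCount 𝒞 l n' N := by
  obtain ⟨f, hf, hN⟩ := h
  exact ⟨f, hf.imp_right fun h => h.trans hn, hN⟩

theorem IsPolynomialCount.congr (h : IsPolynomialCount 𝒞 l n N)
    (e : ∀ m c, 𝒞 m c → N' m c = N m c) : IsPolynomialCount 𝒞 l n N' := by
  obtain ⟨f, hf, hN⟩ := h
  exact ⟨f, hf, fun m c hc => (e m c hc).trans (hN m c hc)⟩

end PolynomialCounts

/-! ### Adding a column to the injective matrix -/

section Extension

variable {F : Type*} [Field F] {m S R : Type*} [Fintype m] [DecidableEq m]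
  [Fintype S] [DecidableEq S] [Fintype R] [DecidableEq R]

theorem hasLeftInv_fromCols_iff (u : Matrix m S F) (w : m → F) :
    HasLeftInv (Matrix.fromCols u (Matrix.replicateCol Unit w)) ↔
      HasLeftInv u ∧ ∀ y, u.mulVec y ≠ w := by
  have hw : ∀ t : Unit → F, (Matrix.replicateCol Unit w).mulVec t = t () • w := fun t => by
    funext i
    simp [Matrix.mulVec, dotProduct, mul_comm]
  simp only [hasLeftInv_iff, Matrix.fromCols_mulVec, hw]
  constructor
  · refine fun h => ⟨fun y hy => ?_, fun y hy => ?_⟩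
    · have := h (Sum.elim y 0) (by simp [hy])
      funext i
      exact congrFun this (Sum.inl i)
    · have := h (Sum.elim y (fun _ => -1)) (by
        simp [hy])
      have := congrFun this (Sum.inr ())
      simp at this
  · rintro ⟨h1, h2⟩ y hy
    have h0 : y (Sum.inr ()) = 0 := by
      by_contra hne
      refine h2 (-(y (Sum.inr ()))⁻¹ • (y ∘ Sum.inl)) ?_
      rw [Matrix.mulVec_smul, eq_neg_of_add_eq_zero_left hy, Function.comp_apply, smul_neg,
        neg_smul, neg_neg, smul_smul, inv_mul_cancel₀ hne, one_smul]
    rw [Function.comp_apply, h0, zero_smul, add_zero] at hy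
    funext i
    rcases i with i | i
    · exact congrFun (h1 _ hy) i
    · exact h0

/-- A zero last row of `M` removes the last column `w` of `u` from the product `u * M * v`. What
remains is `v w = b` and independence of `w` from the other columns, and by `natCard_extensions` the
number of such `w` is the same for every pair. -/
theorem pairCount_fromRows [Fintype F] (M : Matrix S R F) (B : Matrix R S F) (b : R → F)
    (c : Matrix m m F) :
    (pairCount (Matrix.fromRows M (0 : Matrix Unit R F))
      (Matrix.fromCols B (Matrix.replicateCol Unit b)) c : ℚ) =
      pairCount M B c * ((Fintype.card F : ℚ) ^ Fintype.card m /
        (Fintype.card F : ℚ) ^ Fintype.card R - Nat.card {y : S → F // B.mulVec y = b}) := by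
  classical
  let T := {p : Matrix m S F × Matrix R m F //
    HasLeftInv p.1 ∧ HasRightInv p.2 ∧ p.2 * p.1 = B ∧ p.1 * M * p.2 = c}
  let E : T → Type _ := fun p => {w : m → F // p.1.2.mulVec w = b ∧ ∀ y, p.1.1.mulVec y ≠ w}
  have hmul : ∀ (v : Matrix R m F) (u : Matrix m S F) (w : m → F),
      v * Matrix.fromCols u (Matrix.replicateCol Unit w) =
        Matrix.fromCols (v * u) (Matrix.replicateCol Unit (v.mulVec w)) := fun v u w => by
    rw [Matrix.mul_fromCols]
    congr 1
  have hmul' : ∀ (u : Matrix m S F) (w : m → F),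
      Matrix.fromCols u (Matrix.replicateCol Unit w) * Matrix.fromRows M (0 : Matrix Unit R F) =
        u * M := fun u w => by
    rw [Matrix.fromCols_mul_fromRows, Matrix.mul_zero, add_zero]
  have hinj : ∀ {n : Type _} {u u' : Matrix n S F} {w w' : n → F},
      Matrix.fromCols u (Matrix.replicateCol Unit w) =
        Matrix.fromCols u' (Matrix.replicateCol Unit w') → u = u' ∧ w = w' := by
    intro n u u' w w' h
    constructor
    · ext i j
      exact congrFun (congrFun h i) (Sum.inl j)
    · ext i
      exact congrFun (congrFun h i) (Sum.inr ())
  have e : (Σ p : T, E p) ≃ {p : Matrix m (S ⊕ Unit) F × Matrix R m F //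
      HasLeftInv p.1 ∧ HasRightInv p.2 ∧
        p.2 * p.1 = Matrix.fromCols B (Matrix.replicateCol Unit b) ∧
        p.1 * Matrix.fromRows M (0 : Matrix Unit R F) * p.2 = c} := by
    refine Equiv.ofBijective (fun z => ⟨(Matrix.fromCols z.1.1.1
      (Matrix.replicateCol Unit z.2.1), z.1.1.2), ?_⟩) ⟨?_, ?_⟩
    · obtain ⟨h1, h2, h3, h4⟩ := z.1.2
      refine ⟨(hasLeftInv_fromCols_iff _ _).2 ⟨h1, z.2.2.2⟩, h2, ?_, ?_⟩
      · exact (hmul _ _ _).trans (by rw [h3, z.2.2.1])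
      · exact (congrArg (· * z.1.1.2) (hmul' _ _)).trans h4
    · rintro ⟨⟨⟨u, v⟩, hp⟩, ⟨w, hw⟩⟩ ⟨⟨⟨u', v'⟩, hp'⟩, ⟨w', hw'⟩⟩ h
      have h := Prod.ext_iff.1 (congrArg Subtype.val h)
      obtain ⟨h1, h2⟩ := h
      obtain ⟨rfl, rfl⟩ := hinj h1
      have h2 : v = v' := h2
      subst h2
      rfl
    · rintro ⟨⟨u, v⟩, h1, h2, h3, h4⟩
      have hu : u = Matrix.fromCols u.toCols₁ (Matrix.replicateCol Unit fun i => u i (Sum.inr ())) := by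
        ext i j
        rcases j with j | j <;> rfl
      simp only at h1 h2 h3 h4
      rw [hu] at h1 h3 h4
      rw [hmul] at h3
      rw [hmul'] at h4
      obtain ⟨h1, h5⟩ := (hasLeftInv_fromCols_iff _ _).1 h1
      have h6 : v * u.toCols₁ = B ∧ v.mulVec (fun i => u i (Sum.inr ())) = b := by
        constructor
        · ext i j
          exact congrFun (congrFun h3 i) (Sum.inl j)
        · ext i
          exact congrFun (congrFun h3 i) (Sum.inr ())
      refine ⟨⟨⟨(u.toCols₁, v), h1, h2, h6.1, h4⟩, ⟨_, h6.2, h5⟩⟩, Subtype.ext (Prod.ext ?_ rfl)⟩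
      exact hu.symm
  have hE : ∀ p : T, (Nat.card (E p) : ℚ) = ((Fintype.card F : ℚ) ^ Fintype.card m /
      (Fintype.card F : ℚ) ^ Fintype.card R - Nat.card {y : S → F // B.mulVec y = b}) := by
    intro p
    obtain ⟨h1, h2, h3, h4⟩ := p.2
    rw [natCard_extensions h1 h2, h3]
  have := Fintype.ofFinite T
  unfold pairCount
  rw [← Nat.card_congr e, Nat.card_sigma, Nat.cast_sum, Finset.sum_congr rfl fun p _ => hE p,
    Finset.sum_const, Finset.card_univ, nsmul_eq_mul, ← Nat.card_eq_fintype_card]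

/-- A nonzero vector is a row of an invertible matrix. -/
theorem exists_invertible_row {s : ℕ} {z : Fin (s + 1) → F} (hz : z ≠ 0) :
    ∃ (P : Matrix (Fin s ⊕ Unit) (Fin (s + 1)) F) (Q : Matrix (Fin (s + 1)) (Fin s ⊕ Unit) F),
      P * Q = 1 ∧ Q * P = 1 ∧ P (Sum.inr ()) = z := by
  classical
  have hs : LinearIndepOn F id {z} := LinearIndepOn.singleton hz
  let b := Module.Basis.extend hs
  have hzI : z ∈ hs.extend (Set.subset_univ _) := Module.Basis.subset_extend hs rfl
  have hfin : Finite (hs.extend (Set.subset_univ _)) := Module.Finite.finite_basis b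
  have hcard : Nat.card (hs.extend (Set.subset_univ _)) = Nat.card (Fin s ⊕ Unit) := by
    rw [← Module.finrank_eq_nat_card_basis b, Module.finrank_fin_fun, Nat.card_sum,
      Nat.card_eq_fintype_card, Nat.card_eq_fintype_card, Fintype.card_fin, Fintype.card_unit]
  let e : hs.extend (Set.subset_univ _) ≃ Fin s ⊕ Unit :=
    (Finite.card_eq.1 hcard).some
  -- The swap places `z` at the index `Sum.inr ()`.
  let b' := b.reindex (e.trans (Equiv.swap (e ⟨z, hzI⟩) (Sum.inr ())))
  refine ⟨((Pi.basisFun F (Fin (s + 1))).toMatrix b').transpose,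
    (b'.toMatrix (Pi.basisFun F (Fin (s + 1)))).transpose, ?_, ?_, ?_⟩
  · rw [← Matrix.transpose_mul, Module.Basis.toMatrix_mul_toMatrix_flip, Matrix.transpose_one]
  · rw [← Matrix.transpose_mul, Module.Basis.toMatrix_mul_toMatrix_flip, Matrix.transpose_one]
  · have hb : b' (Sum.inr ()) = z := by
      simp only [b', Module.Basis.reindex_apply, Equiv.symm_trans_apply, Equiv.symm_swap,
        Equiv.swap_apply_right, Equiv.symm_apply_apply]
      exact Module.Basis.extend_apply_self hs ⟨z, hzI⟩
    funext j
    rw [Matrix.transpose_apply, Module.Basis.toMatrix_apply, hb, Pi.basisFun_repr]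

theorem HasLeftInv.card_le {u : Matrix m S F} (h : HasLeftInv u) :
    Fintype.card S ≤ Fintype.card m := by
  have hi : LinearMap.ker (Matrix.toLin' u) = ⊥ := LinearMap.ker_eq_bot'.2 (hasLeftInv_iff.1 h)
  have := LinearMap.finrank_le_finrank_of_injective (LinearMap.ker_eq_bot.1 hi)
  simpa using this

theorem HasRightInv.card_le {v : Matrix R m F} (h : HasRightInv v) :
    Fintype.card R ≤ Fintype.card m :=
  h.transpose.card_le

end Extension

/-! ### Polynomiality of the pair counts -/

section PairCountPolynomial

variable {F : Type*} [Field F] [Fintype F] {𝒞 : ∀ m : ℕ, Matrix (Fin m) (Fin m) F → Prop}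
  {l n s r : ℕ}

/-- A vector of the left kernel of `M`, taken as last row of a base change, gives `P * M` a zero
last row. Removing that row divides the count by a factor linear in `q ^ m`. -/
theorem isPolynomialCount_pairCount_succ {M : Matrix (Fin (s + 1)) (Fin r) F}
    {z : Fin (s + 1) → F} (hz : z ≠ 0) (hzM : Matrix.vecMul z M = 0)
    (ih : ∀ (M' : Matrix (Fin s) (Fin r) F) (B' : Matrix (Fin r) (Fin s) F),
      IsPolynomialCount 𝒞 l n fun _ c => pairCount M' B' c) (B : Matrix (Fin r) (Fin (s + 1)) F) :
    IsPolynomialCount 𝒞 l (n + 1) fun _ c => pairCount M B c := by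
  obtain ⟨P, Q, hPQ, hQP, hPz⟩ := exists_invertible_row hz
  obtain ⟨f, hf, hN⟩ := ih (P * M).toRows₁ (B * Q).toCols₁
  have hM : P * M = Matrix.fromRows (P * M).toRows₁ (0 : Matrix Unit (Fin r) F) := by
    ext i j
    rcases i with i | i
    · rfl
    · have := congrFun hzM j
      rw [← hPz] at this
      exact this
  have hB : B * Q = Matrix.fromCols (B * Q).toCols₁
      (Matrix.replicateCol Unit fun i => (B * Q) i (Sum.inr ())) := by
    ext i j
    rcases j with j | j <;> rfl
  set k : ℚ := ((Nat.card {y : Fin s → F // (B * Q).toCols₁.mulVec y =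
    fun i => (B * Q) i (Sum.inr ())} : ℕ) : ℚ) with hk
  -- The linear factor is the number `q ^ (m - r) - k` of admissible last columns, with `k`
  -- independent of `m`.
  refine ⟨f * (C ((Fintype.card F : ℚ) ^ r)⁻¹ * X - C k), ?_, fun m c hc => ?_⟩
  · rcases hf with rfl | hf
    · left; rw [zero_mul]
    · right
      have h1 := natDegree_mul_le (p := f) (q := C ((Fintype.card F : ℚ) ^ r)⁻¹ * X - C k)
      have h2 : (C ((Fintype.card F : ℚ) ^ r)⁻¹ * X - C k).natDegree ≤ 1 := by
        rw [natDegree_sub_C]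
        exact (natDegree_C_mul_le _ _).trans natDegree_X_le
      omega
  · beta_reduce
    have hN := hN m c hc
    beta_reduce at hN
    rw [← pairCount_congr hPQ hQP, hM, hB, pairCount_fromRows, hN, Fintype.card_fin,
      Fintype.card_fin, eval_mul, eval_sub, eval_mul, eval_C, eval_X, eval_C, div_eq_inv_mul, hk]

/-- The base case: `M` is invertible. -/
theorem pairCount_of_invertible {A : Matrix (Fin l) (Fin l) F} {M M' : Matrix (Fin s) (Fin s) F}
    (h1 : M * M' = 1) (h2 : M' * M = 1) (B : Matrix (Fin s) (Fin s) F) {m : ℕ}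
    {u₀ : Matrix (Fin m) (Fin l) F} {v₀ : Matrix (Fin l) (Fin m) F} (hu₀ : HasLeftInv u₀)
    (hv₀ : HasRightInv v₀) (hA : v₀ * u₀ = A) :
    pairCount M B (u₀ * v₀) =
      Nat.card {p : Matrix (Fin l) (Fin s) F × Matrix (Fin s) (Fin l) F //
        p.1 * p.2 = 1 ∧ p.2 * p.1 = 1 ∧ p.2 * A * p.1 * M' = B} := by
  have hM' : HasLeftInv M' := ⟨M, h1⟩
  have hM'' : HasRightInv M' := ⟨M, h2⟩
  have h3 : ∀ p : Matrix (Fin l) (Fin s) F × Matrix (Fin s) (Fin l) F,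
      p.2 * A * p.1 * M' = B → p.2 * v₀ * (u₀ * p.1 * M') = B := by
    intro p hB
    rw [← hB, ← hA]
    simp only [Matrix.mul_assoc]
  have h4 : ∀ p : Matrix (Fin l) (Fin s) F × Matrix (Fin s) (Fin l) F,
      p.1 * p.2 = 1 → u₀ * p.1 * M' * M * (p.2 * v₀) = u₀ * v₀ := by
    intro p hxy
    rw [Matrix.mul_assoc _ M', h2, Matrix.mul_one, Matrix.mul_assoc, ← Matrix.mul_assoc p.1,
      hxy, Matrix.one_mul]
  refine (Nat.card_congr (Equiv.ofBijective
    (fun p => ⟨(u₀ * p.1.1 * M', p.1.2 * v₀), by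
      obtain ⟨hxy, hyx, hB⟩ := p.2
      exact ⟨(hu₀.mul ⟨_, hyx⟩).mul hM', HasRightInv.mul ⟨_, hyx⟩ hv₀, h3 _ hB, h4 _ hxy⟩⟩)
    ⟨?_, ?_⟩)).symm
  · rintro ⟨⟨x, y⟩, hp⟩ ⟨⟨x', y'⟩, hp'⟩ h
    obtain ⟨ha, hb⟩ := Prod.ext_iff.1 (congrArg Subtype.val h)
    exact Subtype.ext (Prod.ext (hu₀.cancel (hM''.cancel ha)) (hv₀.cancel hb))
  · rintro ⟨⟨u, v⟩, ⟨L, hL⟩, ⟨R, hR⟩, hB, hc⟩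
    obtain ⟨L₀, hL₀⟩ := hu₀
    simp only at hL hR hB hc
    -- Both `(u * M) * v` and `u₀ * v₀` are rank factorizations of `c`, so they differ by an
    -- invertible `x = L₀ * u * M`, with inverse `y = M' * L * u₀`.
    have e1 : L₀ * u * M * v = v₀ := by
      calc L₀ * u * M * v = L₀ * (u * M * v) := by simp only [Matrix.mul_assoc]
        _ = v₀ := by rw [hc, ← Matrix.mul_assoc, hL₀, Matrix.one_mul]
    have e2 : M' * L * u₀ * v₀ = v := by
      calc M' * L * u₀ * v₀ = M' * L * (u * M * v) := by rw [hc]; simp only [Matrix.mul_assoc]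
        _ = M' * (L * u) * M * v := by simp only [Matrix.mul_assoc]
        _ = v := by rw [hL, Matrix.mul_one, h2, Matrix.one_mul]
    have e3 : u₀ * (L₀ * u * M) = u * M := by
      have : u * M = u₀ * v₀ * R := by rw [← hc, Matrix.mul_assoc, hR, Matrix.mul_one]
      rw [Matrix.mul_assoc L₀, this, ← Matrix.mul_assoc L₀, ← Matrix.mul_assoc L₀, hL₀,
        Matrix.one_mul, Matrix.mul_assoc u₀]
    have hu : u₀ * (L₀ * u * M) * M' = u := by
      rw [e3, Matrix.mul_assoc, h1, Matrix.mul_one]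
    refine ⟨⟨(L₀ * u * M, M' * L * u₀), ?_, ?_, ?_⟩, Subtype.ext (Prod.ext hu e2)⟩
    · refine hv₀.cancel ?_
      rw [Matrix.mul_assoc, e2, e1, Matrix.one_mul]
    · refine HasRightInv.cancel ⟨R, hR⟩ ?_
      rw [Matrix.mul_assoc, e1, e2, Matrix.one_mul]
    · rw [← hB]
      change M' * L * u₀ * A * (L₀ * u * M) * M' = v * u
      calc M' * L * u₀ * A * (L₀ * u * M) * M'
          = (M' * L * u₀ * v₀) * (u₀ * (L₀ * u * M) * M') := by
            rw [← hA]; simp only [Matrix.mul_assoc]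
        _ = v * u := by rw [e2, hu]

/-- For `c = u₀ v₀` with `v₀ u₀ = A` fixed, the number of pairs `(u, v)` is a polynomial in
`q ^ m`. -/
theorem isPolynomialCount_pairCount (A : Matrix (Fin l) (Fin l) F)
    (M : Matrix (Fin s) (Fin r) F) (B : Matrix (Fin r) (Fin s) F) :
    IsPolynomialCount (fun m c => ∃ (u : Matrix (Fin m) (Fin l) F) (v : Matrix (Fin l) (Fin m) F),
      HasLeftInv u ∧ HasRightInv v ∧ c = u * v ∧ v * u = A) l (s + r)
      fun _ c => pairCount M B c := by
  induction hn : s + r using Nat.strong_induction_on generalizing l s r with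
  | _ n ih =>
  by_cases h1 : ∃ z : Fin s → F, z ≠ 0 ∧ Matrix.vecMul z M = 0
  · obtain ⟨z, hz, hzM⟩ := h1
    obtain _ | s := s
    · exact absurd (Subsingleton.elim z 0) hz
    obtain _ | n := n
    · omega
    exact isPolynomialCount_pairCount_succ hz hzM
      (fun M' B' => ih n (Nat.lt_succ_self n) A M' B' (by omega)) B
  by_cases h2 : ∃ y : Fin r → F, y ≠ 0 ∧ M.mulVec y = 0
  · obtain ⟨y, hy, hyM⟩ := h2
    obtain _ | r := r
    · exact absurd (Subsingleton.elim y 0) hy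
    obtain _ | n := n
    · omega
    -- Transposition turns a right kernel vector into a left one. The class used consists of the `c`
    -- whose transpose has corner `A`, so the induction hypothesis applies with `A` unchanged.
    obtain ⟨f, hf, hN⟩ := isPolynomialCount_pairCount_succ (𝒞 := fun m c =>
      ∃ (u : Matrix (Fin m) (Fin l) F) (v : Matrix (Fin l) (Fin m) F),
        HasLeftInv u ∧ HasRightInv v ∧ c.transpose = u * v ∧ v * u = A) (l := l) (n := n)
      (M := M.transpose) hy (by rw [Matrix.vecMul_transpose, hyM]) (fun M' B' => by
        obtain ⟨f, hf, hN⟩ := ih n (Nat.lt_succ_self n) A M'.transpose B'.transpose (by omega)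
        refine ⟨f, hf, fun m c hc => ?_⟩
        rw [← hN m c.transpose hc]
        beta_reduce
        rw [pairCount_transpose]) B.transpose
    refine ⟨f, hf, fun m c hc => ?_⟩
    rw [← hN m c.transpose (by beta_reduce; rwa [Matrix.transpose_transpose])]
    beta_reduce
    rw [pairCount_transpose]
  have h1 : HasLeftInv M.transpose := hasLeftInv_iff.2 fun z hz => by
    by_contra h
    exact h1 ⟨z, h, by rwa [Matrix.mulVec_transpose] at hz⟩
  have h2 : HasLeftInv M := hasLeftInv_iff.2 fun y hy => by
    by_contra h
    exact h2 ⟨y, h, hy⟩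
  -- With no kernel on either side, `M` is square and invertible.
  obtain rfl : r = s := le_antisymm (by simpa using h2.card_le) (by simpa using h1.card_le)
  obtain ⟨M', hM'⟩ := h2
  have hM := mul_eq_one_comm.1 hM'
  refine ⟨C ((Nat.card {p : Matrix (Fin l) (Fin r) F × Matrix (Fin r) (Fin l) F //
    p.1 * p.2 = 1 ∧ p.2 * p.1 = 1 ∧ p.2 * A * p.1 * M' = B} : ℕ) : ℚ), ?_, ?_⟩
  · by_cases h0 : Nonempty {p : Matrix (Fin l) (Fin r) F × Matrix (Fin r) (Fin l) F //
      p.1 * p.2 = 1 ∧ p.2 * p.1 = 1 ∧ p.2 * A * p.1 * M' = B}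
    · right
      obtain ⟨⟨x, y⟩, hxy, hyx, -⟩ := h0
      have : Fintype.card (Fin l) ≤ Fintype.card (Fin r) := HasRightInv.card_le ⟨y, hxy⟩
      rw [Fintype.card_fin, Fintype.card_fin] at this
      rw [natDegree_C]
      omega
    · left
      have := not_nonempty_iff.1 h0
      rw [Nat.card_of_isEmpty, Nat.cast_zero, C_0]
  · rintro m c ⟨u, v, hu, hv, rfl, hA⟩
    beta_reduce
    rw [eval_C, pairCount_of_invertible hM hM' B hu hv hA]

end PairCountPolynomial

/-! ### Frames of a pair of matrices -/

section Frames

variable {F : Type*} [Field F] {m S R : Type*} [Fintype m] [DecidableEq m]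
  [Fintype S] [DecidableEq S] [Fintype R] [DecidableEq R]

/-- The images of `α` and `β` span, and their kernels meet trivially. -/
def IsReducedPair (α β : Matrix S R F) : Prop :=
  (∃ p q : Matrix R S F, α * p + β * q = 1) ∧ ∃ p q : Matrix R S F, p * α + q * β = 1

/-- The ways to write `a = u α v` and `b = u β v` with `u` injective onto the sum of the images and
`v` surjective with kernel the intersection of the kernels. -/
def Frame (S R : Type*) [Fintype S] [DecidableEq S] [Fintype R] [DecidableEq R]
    (a b : Matrix m m F) : Type _ :=
  {z : (Matrix m S F × Matrix R m F) × (Matrix S R F × Matrix S R F) //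
    HasLeftInv z.1.1 ∧ HasRightInv z.1.2 ∧ IsReducedPair z.2.1 z.2.2 ∧
      z.1.1 * z.2.1 * z.1.2 = a ∧ z.1.1 * z.2.2 * z.1.2 = b}

/-- Factor `[a b] = u * w` by rank, then stack the two blocks of `w` vertically and factor again as
`y * v`; the blocks of `y` are `α` and `β`. The one-sided inverses of `w` and `y` supply the two
reducedness identities. -/
theorem exists_frame (a b : Matrix m m F) : ∃ s r : ℕ, Nonempty (Frame (Fin s) (Fin r) a b) := by
  obtain ⟨s, u, w, hu, ⟨W, hW⟩, huw⟩ := exists_rank_factorization (Matrix.fromCols a b)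
  obtain ⟨r, y, v, ⟨Y, hY⟩, hv, hyv⟩ :=
    exists_rank_factorization (Matrix.fromRows w.toCols₁ w.toCols₂)
  have h1 : w.toCols₁ = y.toRows₁ * v := by
    ext i j
    exact congrFun (congrFun hyv (Sum.inl i)) j
  have h2 : w.toCols₂ = y.toRows₂ * v := by
    ext i j
    exact congrFun (congrFun hyv (Sum.inr i)) j
  have h3 : u * w.toCols₁ = a := by
    ext i j
    exact (congrFun (congrFun huw i) (Sum.inl j)).symm
  have h4 : u * w.toCols₂ = b := by
    ext i j
    exact (congrFun (congrFun huw i) (Sum.inr j)).symm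
  refine ⟨s, r, ⟨⟨((u, v), (y.toRows₁, y.toRows₂)), hu, hv,
    ⟨⟨v * W.toRows₁, v * W.toRows₂, ?_⟩, ⟨Y.toCols₁, Y.toCols₂, ?_⟩⟩, ?_, ?_⟩⟩⟩
  · change y.toRows₁ * (v * W.toRows₁) + y.toRows₂ * (v * W.toRows₂) = 1
    rw [← Matrix.mul_assoc, ← Matrix.mul_assoc, ← h1, ← h2, ← Matrix.fromCols_mul_fromRows,
      Matrix.fromCols_toCols, Matrix.fromRows_toRows, hW]
  · change Y.toCols₁ * y.toRows₁ + Y.toCols₂ * y.toRows₂ = 1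
    rw [← Matrix.fromCols_mul_fromRows, Matrix.fromCols_toCols, Matrix.fromRows_toRows, hY]
  · rw [← h3, h1, Matrix.mul_assoc]
  · rw [← h4, h2, Matrix.mul_assoc]

variable {S' R' : Type*} [Fintype S'] [DecidableEq S'] [Fintype R'] [DecidableEq R']

/-- The image of `u'` is spanned by those of `u' * α'` and `u' * β'`, which are the images of `a`
and `b` since `v'` is surjective, and these lie in the image of `u`. -/
theorem Frame.exists_left {a b : Matrix m m F} (z : Frame S R a b) (z' : Frame S' R' a b) :
    ∃ x : Matrix S S' F, z'.1.1.1 = z.1.1.1 * x := by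
  obtain ⟨⟨⟨u, v⟩, ⟨α, β⟩⟩, hu, hv, -, ha, hb⟩ := z
  obtain ⟨⟨⟨u', v'⟩, ⟨α', β'⟩⟩, hu', ⟨V, hV⟩, ⟨⟨p, q, hpq⟩, -⟩, ha', hb'⟩ := z'
  simp only at *
  refine ⟨α * v * V * p + β * v * V * q, ?_⟩
  calc u' = u' * (α' * p + β' * q) := by rw [hpq, Matrix.mul_one]
    _ = u' * α' * (v' * V) * p + u' * β' * (v' * V) * q := by
      rw [hV, Matrix.mul_one, Matrix.mul_one, Matrix.mul_add]; simp only [Matrix.mul_assoc]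
    _ = (u' * α' * v') * V * p + (u' * β' * v') * V * q := by simp only [Matrix.mul_assoc]
    _ = u * (α * v * V * p + β * v * V * q) := by
      rw [ha', hb', ← ha, ← hb, Matrix.mul_add]; simp only [Matrix.mul_assoc]

theorem Frame.exists_right {a b : Matrix m m F} (z : Frame S R a b) (z' : Frame S' R' a b) :
    ∃ y : Matrix R' R F, z'.1.1.2 = y * z.1.1.2 := by
  obtain ⟨⟨⟨u, v⟩, ⟨α, β⟩⟩, hu, hv, -, ha, hb⟩ := z
  obtain ⟨⟨⟨u', v'⟩, ⟨α', β'⟩⟩, ⟨U, hU⟩, hv', ⟨-, ⟨p, q, hpq⟩⟩, ha', hb'⟩ := z'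
  simp only at *
  refine ⟨p * U * u * α + q * U * u * β, ?_⟩
  calc v' = (p * α' + q * β') * v' := by rw [hpq, Matrix.one_mul]
    _ = p * (U * u') * α' * v' + q * (U * u') * β' * v' := by
      rw [hU, Matrix.mul_one, Matrix.mul_one, Matrix.add_mul]
    _ = p * U * (u' * α' * v') + q * U * (u' * β' * v') := by simp only [Matrix.mul_assoc]
    _ = (p * U * u * α + q * U * u * β) * v := by
      rw [ha', hb', ← ha, ← hb, Matrix.add_mul]; simp only [Matrix.mul_assoc]

theorem Frame.exists_equiv_left {a b : Matrix m m F} (z : Frame S R a b)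
    (z' : Frame S' R' a b) :
    ∃ (x : Matrix S S' F) (x' : Matrix S' S F), x * x' = 1 ∧ x' * x = 1 ∧
      z'.1.1.1 = z.1.1.1 * x := by
  obtain ⟨x, hx⟩ := z.exists_left z'
  obtain ⟨x', hx'⟩ := z'.exists_left z
  refine ⟨x, x', z.2.1.cancel ?_, z'.2.1.cancel ?_, hx⟩
  · rw [← Matrix.mul_assoc, ← hx, ← hx', Matrix.mul_one]
  · rw [← Matrix.mul_assoc, ← hx', ← hx, Matrix.mul_one]

theorem Frame.exists_equiv_right {a b : Matrix m m F} (z : Frame S R a b)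
    (z' : Frame S' R' a b) :
    ∃ (y : Matrix R' R F) (y' : Matrix R R' F), y * y' = 1 ∧ y' * y = 1 ∧
      z'.1.1.2 = y * z.1.1.2 := by
  obtain ⟨y, hy⟩ := z.exists_right z'
  obtain ⟨y', hy'⟩ := z'.exists_right z
  refine ⟨y, y', z'.2.2.1.cancel ?_, z.2.2.1.cancel ?_, hy⟩
  · rw [Matrix.mul_assoc, ← hy', ← hy, Matrix.one_mul]
  · rw [Matrix.mul_assoc, ← hy, ← hy', Matrix.one_mul]

theorem Frame.card_left_eq {a b : Matrix m m F} (z : Frame S R a b) (z' : Frame S' R' a b) :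
    Fintype.card S = Fintype.card S' := by
  obtain ⟨x, x', h1, h2, -⟩ := z.exists_equiv_left z'
  exact le_antisymm (HasRightInv.card_le ⟨x', h1⟩) (HasRightInv.card_le ⟨x, h2⟩)

theorem Frame.card_right_eq {a b : Matrix m m F} (z : Frame S R a b) (z' : Frame S' R' a b) :
    Fintype.card R = Fintype.card R' := by
  obtain ⟨x, x', h1, h2, -⟩ := z.exists_equiv_right z'
  exact le_antisymm (HasRightInv.card_le ⟨x, h2⟩) (HasRightInv.card_le ⟨x', h1⟩)

theorem IsReducedPair.mul {α β : Matrix S R F} (h : IsReducedPair α β) {x x' : Matrix S S F}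
    {y y' : Matrix R R F} (hx : x * x' = 1) (hy : y * y' = 1) :
    IsReducedPair (x' * α * y') (x' * β * y') := by
  obtain ⟨⟨p, q, h1⟩, ⟨p', q', h2⟩⟩ := h
  have hx' := mul_eq_one_comm.1 hx
  have hy' := mul_eq_one_comm.1 hy
  refine ⟨⟨y * p * x, y * q * x, ?_⟩, ⟨y * p' * x, y * q' * x, ?_⟩⟩
  · calc x' * α * y' * (y * p * x) + x' * β * y' * (y * q * x)
        = x' * α * (y' * y) * p * x + x' * β * (y' * y) * q * x := by
          simp only [Matrix.mul_assoc]
      _ = x' * (α * p + β * q) * x := by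
          rw [hy', Matrix.mul_one, Matrix.mul_one, Matrix.mul_add, Matrix.add_mul]
          simp only [Matrix.mul_assoc]
      _ = 1 := by rw [h1, Matrix.mul_one, hx']
  · calc y * p' * x * (x' * α * y') + y * q' * x * (x' * β * y')
        = y * p' * (x * x') * α * y' + y * q' * (x * x') * β * y' := by
          simp only [Matrix.mul_assoc]
      _ = y * (p' * α + q' * β) * y' := by
          rw [hx, Matrix.mul_one, Matrix.mul_one, Matrix.mul_add, Matrix.add_mul]
          simp only [Matrix.mul_assoc]
      _ = 1 := by rw [h2, Matrix.mul_one, hy]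

theorem GL_mul_inv (g : GL S F) : (g : Matrix S S F) * ((g⁻¹ : GL S F) : Matrix S S F) = 1 := by
  rw [← Units.val_mul, mul_inv_cancel, Units.val_one]

theorem GL_inv_mul (g : GL S F) : ((g⁻¹ : GL S F) : Matrix S S F) * (g : Matrix S S F) = 1 := by
  rw [← Units.val_mul, inv_mul_cancel, Units.val_one]

/-- Frames form a torsor under `GL_S × GL_R`. -/
theorem natCard_frame {a b : Matrix m m F} (z : Frame S R a b) :
    Nat.card (Frame S R a b) = Nat.card (GL S F) * Nat.card (GL R F) := by
  obtain ⟨⟨⟨u, v⟩, ⟨α, β⟩⟩, hu, hv, hr, ha, hb⟩ := z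
  simp only at hu hv hr ha hb
  have key : ∀ (g : GL S F) (h : GL R F) (γ : Matrix S R F),
      u * (g : Matrix S S F) * (((g⁻¹ : GL S F) : Matrix S S F) * γ * ((h⁻¹ : GL R F) : Matrix R R F)) * ((h : Matrix R R F) * v) =
        u * γ * v := by
    intro g h γ
    calc _ = u * ((g : Matrix S S F) * ((g⁻¹ : GL S F) : Matrix S S F)) * γ *
          (((h⁻¹ : GL R F) : Matrix R R F) * (h : Matrix R R F)) * v := by
          simp only [Matrix.mul_assoc]
      _ = _ := by rw [← Units.val_mul, ← Units.val_mul, mul_inv_cancel, inv_mul_cancel,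
          Units.val_one, Units.val_one, Matrix.mul_one, Matrix.mul_one]
  rw [← Nat.card_prod]
  refine (Nat.card_congr (Equiv.ofBijective (fun x : GL S F × GL R F =>
    (⟨((u * (x.1 : Matrix S S F), (x.2 : Matrix R R F) * v),
      (((x.1⁻¹ : GL S F) : Matrix S S F) * α * ((x.2⁻¹ : GL R F) : Matrix R R F),
        ((x.1⁻¹ : GL S F) : Matrix S S F) * β * ((x.2⁻¹ : GL R F) : Matrix R R F))),
      hu.mul ⟨_, GL_inv_mul x.1⟩, HasRightInv.mul ⟨_, GL_mul_inv x.2⟩ hv, hr.mul (GL_mul_inv x.1) (GL_mul_inv x.2),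
      (key _ _ _).trans ha, (key _ _ _).trans hb⟩ : Frame S R a b)) ⟨?_, ?_⟩)).symm
  · rintro ⟨g, h⟩ ⟨g', h'⟩ e
    obtain ⟨h1, -⟩ := Prod.ext_iff.1 (congrArg Subtype.val e)
    obtain ⟨h1, h2⟩ := Prod.ext_iff.1 h1
    exact Prod.ext (Units.ext (hu.cancel h1)) (Units.ext (hv.cancel h2))
  · intro z'
    let z : Frame S R a b := ⟨((u, v), (α, β)), hu, hv, hr, ha, hb⟩
    obtain ⟨x, x', h1, h2, hx⟩ := z.exists_equiv_left z'
    obtain ⟨y, y', h3, h4, hy⟩ := z.exists_equiv_right z'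
    have hx : z'.1.1.1 = u * x := hx
    have hy : z'.1.1.2 = y * v := hy
    have hγ : ∀ γ γ' : Matrix S R F, z'.1.1.1 * γ' * z'.1.1.2 = u * γ * v → x' * γ * y' = γ' := by
      intro γ γ' h
      rw [hx, hy] at h
      have h : x * γ' * y = γ := by
        refine hu.cancel (hv.cancel ?_)
        rw [← h]
        simp only [Matrix.mul_assoc]
      calc x' * γ * y' = (x' * x) * γ' * (y * y') := by rw [← h]; simp only [Matrix.mul_assoc]
        _ = γ' := by rw [h2, h3, Matrix.one_mul, Matrix.mul_one]
    obtain ⟨-, -, -, ha', hb'⟩ := z'.2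
    exact ⟨(⟨x, x', h1, h2⟩, ⟨y, y', h3, h4⟩), Subtype.ext (Prod.ext
      (Prod.ext hx.symm hy.symm)
      (Prod.ext (hγ _ _ (ha'.trans ha.symm)) (hγ _ _ (hb'.trans hb.symm))))⟩

end Frames

/-! ### Counting factorizations through frames -/

section ProductCount

variable {F : Type*} [Field F] {m : Type*} [Fintype m] [DecidableEq m]

/-- The pairs `(a, b)` with `1 + a`, `1 + b` of modified types `μ`, `ν` and product `1 + c`. -/
def FactorPair (μ ν : MultiPart F) (c : Matrix m m F) : Type _ :=
  {p : Matrix m m F × Matrix m m F //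
    IsClass p.1 1 μ ∧ IsClass p.2 1 ν ∧ (1 + p.1) * (1 + p.2) = 1 + c}

instance [Finite F] (μ ν : MultiPart F) (c : Matrix m m F) : Finite (FactorPair μ ν c) :=
  inferInstanceAs (Finite {p : Matrix m m F × Matrix m m F //
    IsClass p.1 1 μ ∧ IsClass p.2 1 ν ∧ (1 + p.1) * (1 + p.2) = 1 + c})

/-- The possible coordinates of a factor pair in a frame. -/
def FactorShape (μ ν : MultiPart F) (S R : Type*) [Fintype S] [DecidableEq S] [Fintype R]
    [DecidableEq R] : Type _ :=
  {w : (Matrix S R F × Matrix S R F) × Matrix R S F //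
    IsReducedPair w.1.1 w.1.2 ∧ IsClass w.1.1 w.2 μ ∧ IsClass w.1.2 w.2 ν}

instance [Finite F] (μ ν : MultiPart F) (S R : Type*) [Fintype S] [DecidableEq S] [Fintype R]
    [DecidableEq R] : Finite (FactorShape μ ν S R) :=
  inferInstanceAs (Finite {w : (Matrix S R F × Matrix S R F) × Matrix R S F //
    IsReducedPair w.1.1 w.1.2 ∧ IsClass w.1.1 w.2 μ ∧ IsClass w.1.2 w.2 ν})

variable {S R : Type*} [Fintype S] [DecidableEq S] [Fintype R] [DecidableEq R]

/-- Since `α` and `β` factor through spaces of dimension `|μ|` and `|ν|`, the identities `α * p + β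
* q = 1` and `p * α + q * β = 1` factor the identities of both middle spaces through dimension `|μ|
+ |ν|`. -/
theorem FactorPair.card_le {μ ν : MultiPart F} {c : Matrix m m F} (p : FactorPair μ ν c)
    (z : Frame S R p.1.1 p.1.2) :
    Fintype.card S ≤ μ.size + ν.size ∧ Fintype.card R ≤ μ.size + ν.size := by
  obtain ⟨hu, hv, ⟨⟨p₁, q₁, h1⟩, ⟨p₂, q₂, h2⟩⟩, ha, hb⟩ := z.2
  obtain ⟨α₁, α₂, -, -, hα, -⟩ := (isClass_mul_iff hu hv z.1.2.1 μ).1 (by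
    rw [ha]
    exact p.2.1)
  obtain ⟨β₁, β₂, -, -, hβ, -⟩ := (isClass_mul_iff hu hv z.1.2.2 ν).1 (by
    rw [hb]
    exact p.2.2.1)
  constructor
  · have : HasRightInv (Matrix.fromCols α₁ β₁) :=
      ⟨Matrix.fromRows (α₂ * p₁) (β₂ * q₁), by
        rw [Matrix.fromCols_mul_fromRows, ← Matrix.mul_assoc, ← Matrix.mul_assoc, ← hα, ← hβ, h1]⟩
    simpa using this.card_le
  · have : HasLeftInv (Matrix.fromRows α₂ β₂) :=
      ⟨Matrix.fromCols (p₂ * α₁) (q₂ * β₁), by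
        rw [Matrix.fromCols_mul_fromRows, Matrix.mul_assoc, Matrix.mul_assoc, ← hα, ← hβ, h2]⟩
    simpa using this.card_le

theorem one_add_mul_one_add_frame (u : Matrix m S F) (v : Matrix R m F) (α β : Matrix S R F)
    {a b : Matrix m m F} (ha : u * α * v = a) (hb : u * β * v = b) (c : Matrix m m F) :
    (1 + a) * (1 + b) = 1 + c ↔
      u * (α + β + α * (v * u) * β) * v = c := by
  subst ha hb
  have : (1 + u * α * v) * (1 + u * β * v) = 1 + u * (α + β + α * (v * u) * β) * v := by
    simp only [Matrix.mul_add, Matrix.add_mul, Matrix.mul_one, Matrix.one_mul, Matrix.mul_assoc]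
    abel
  rw [this, add_right_inj]

/-- Framed factor pairs are counted by shape. -/
def framedFactorPairEquiv (μ ν : MultiPart F) (c : Matrix m m F) :
    (Σ p : FactorPair μ ν c, Frame S R p.1.1 p.1.2) ≃
      Σ w : FactorShape μ ν S R, {p : Matrix m S F × Matrix R m F //
        HasLeftInv p.1 ∧ HasRightInv p.2 ∧ p.2 * p.1 = w.1.2 ∧
          p.1 * (w.1.1.1 + w.1.1.2 + w.1.1.1 * w.1.2 * w.1.1.2) * p.2 = c} where
  toFun x := ⟨⟨(x.2.1.2, x.2.1.1.2 * x.2.1.1.1), x.2.2.2.2.1, by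
      obtain ⟨h1, h2, h3, h4, h5⟩ := x.2.2
      refine (isClass_mul_iff h1 h2 _ μ).1 ?_
      rw [h4]
      exact x.1.2.1, by
      obtain ⟨h1, h2, h3, h4, h5⟩ := x.2.2
      refine (isClass_mul_iff h1 h2 _ ν).1 ?_
      rw [h5]
      exact x.1.2.2.1⟩,
    ⟨x.2.1.1, x.2.2.1, x.2.2.2.1, rfl, (one_add_mul_one_add_frame _ _ _ _
      x.2.2.2.2.2.1 x.2.2.2.2.2.2 c).1 x.1.2.2.2⟩⟩
  invFun x := ⟨⟨(x.2.1.1 * x.1.1.1.1 * x.2.1.2, x.2.1.1 * x.1.1.1.2 * x.2.1.2), by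
      obtain ⟨h1, h2, h3, h4⟩ := x.2.2
      refine (isClass_mul_iff h1 h2 _ μ).2 ?_
      rw [h3]
      exact x.1.2.2.1, by
      obtain ⟨h1, h2, h3, h4⟩ := x.2.2
      refine (isClass_mul_iff h1 h2 _ ν).2 ?_
      rw [h3]
      exact x.1.2.2.2, (one_add_mul_one_add_frame _ _ _ _ rfl rfl c).2 (by
      obtain ⟨h1, h2, h3, h4⟩ := x.2.2
      rw [h3]
      exact h4)⟩,
    ⟨(x.2.1, x.1.1.1), x.2.2.1, x.2.2.2.1, x.1.2.1, rfl, rfl⟩⟩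
  left_inv := by
    rintro ⟨⟨⟨a, b⟩, hp⟩, ⟨⟨⟨u, v⟩, ⟨α, β⟩⟩, h1, h2, h3, h4, h5⟩⟩
    simp only at h4 h5
    subst h4 h5
    rfl
  right_inv := by
    rintro ⟨⟨⟨⟨α, β⟩, B⟩, hw⟩, ⟨⟨u, v⟩, h1, h2, h3, h4⟩⟩
    simp only at h3
    subst h3
    rfl

/-- Counting framed pairs with weight the inverse of the order of the acting group counts each pair
once. On the other side framed pairs are sorted by `(α, β, B)`, and each shape contributes a
`pairCount`. -/
theorem natCard_factorPair [Fintype F] (μ ν : MultiPart F) (c : Matrix m m F)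
    [∀ s r : ℕ, Fintype (FactorShape μ ν (Fin s) (Fin r))] :
    (Nat.card (FactorPair μ ν c) : ℚ) =
      ∑ x ∈ Finset.range (μ.size + ν.size + 1) ×ˢ Finset.range (μ.size + ν.size + 1),
        ((Nat.card (GL (Fin x.1) F) * Nat.card (GL (Fin x.2) F) : ℕ) : ℚ)⁻¹ *
          ∑ w : FactorShape μ ν (Fin x.1) (Fin x.2),
            (pairCount (w.1.1.1 + w.1.1.2 + w.1.1.1 * w.1.2 * w.1.1.2) w.1.2 c : ℚ) := by
  classical
  have := Fintype.ofFinite (FactorPair μ ν c)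
  have hF : ∀ (s r : ℕ) (a b : Matrix m m F), Finite (Frame (Fin s) (Fin r) a b) :=
    fun s r a b => Subtype.finite
  have h1 : ∀ x : ℕ × ℕ, ∑ w : FactorShape μ ν (Fin x.1) (Fin x.2),
      (pairCount (w.1.1.1 + w.1.1.2 + w.1.1.1 * w.1.2 * w.1.1.2) w.1.2 c : ℚ) =
      ∑ p : FactorPair μ ν c, (Nat.card (Frame (Fin x.1) (Fin x.2) p.1.1 p.1.2) : ℚ) := by
    intro x
    rw [← Nat.cast_sum, ← Nat.cast_sum]
    congr 1
    unfold pairCount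
    rw [← Nat.card_sigma, ← Nat.card_sigma]
    exact (Nat.card_congr (framedFactorPairEquiv μ ν c)).symm
  have h2 : ∀ p : FactorPair μ ν c,
      ∑ x ∈ Finset.range (μ.size + ν.size + 1) ×ˢ Finset.range (μ.size + ν.size + 1),
        ((Nat.card (GL (Fin x.1) F) * Nat.card (GL (Fin x.2) F) : ℕ) : ℚ)⁻¹ *
          (Nat.card (Frame (Fin x.1) (Fin x.2) p.1.1 p.1.2) : ℚ) = 1 := by
    intro p
    obtain ⟨s, r, ⟨z⟩⟩ := exists_frame p.1.1 p.1.2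
    have hle := p.card_le z
    rw [Fintype.card_fin, Fintype.card_fin] at hle
    -- Only one size `(s, r)` admits frames of a given pair; there the torsor property makes the
    -- weighted count `1`.
    rw [Finset.sum_eq_single (s, r)]
    · rw [natCard_frame z]
      refine inv_mul_cancel₀ (Nat.cast_ne_zero.2 (Nat.mul_ne_zero ?_ ?_))
      · exact Nat.card_pos.ne'
      · exact Nat.card_pos.ne'
    · rintro ⟨s', r'⟩ - hne
      have : IsEmpty (Frame (Fin s') (Fin r') p.1.1 p.1.2) := by
        refine ⟨fun z' => hne ?_⟩
        have e1 := z'.card_left_eq z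
        have e2 := z'.card_right_eq z
        rw [Fintype.card_fin, Fintype.card_fin] at e1 e2
        rw [e1, e2]
      rw [Nat.card_of_isEmpty (α := Frame (Fin s') (Fin r') p.1.1 p.1.2), Nat.cast_zero, mul_zero]
    · intro h
      refine absurd ?_ h
      rw [Finset.mem_product, Finset.mem_range, Finset.mem_range]
      exact ⟨Nat.lt_succ_of_le hle.1, Nat.lt_succ_of_le hle.2⟩
  simp only [h1, Finset.mul_sum]
  rw [Finset.sum_comm, Finset.sum_congr rfl fun p _ => h2 p, Finset.sum_const, Finset.card_univ,
    nsmul_one, Nat.card_eq_fintype_card]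

theorem isPolynomialCount_factorPair [Fintype F] (μ ν lam : MultiPart F)
    {A : Matrix (Fin lam.size) (Fin lam.size) F} (hA : MatrixHasType (1 + A) lam) :
    IsPolynomialCount (fun _ c => IsClass c 1 lam) lam.size (2 * (μ.size + ν.size))
      fun _ c => Nat.card (FactorPair μ ν c) := by
  have : ∀ s r : ℕ, Fintype (FactorShape μ ν (Fin s) (Fin r)) := fun _ _ => Fintype.ofFinite _
  refine IsPolynomialCount.congr ?_ fun m c _ => natCard_factorPair μ ν c
  refine IsPolynomialCount.sum _ fun x hx => IsPolynomialCount.const_mul ?_ _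
  refine IsPolynomialCount.sum _ fun w _ => ?_
  rw [Finset.mem_product, Finset.mem_range, Finset.mem_range] at hx
  obtain ⟨f, hf, hN⟩ := (isPolynomialCount_pairCount A
    (w.1.1.1 + w.1.1.2 + w.1.1.1 * w.1.2 * w.1.1.2) w.1.2).mono
    (n' := 2 * (μ.size + ν.size)) (by omega)
  exact ⟨f, hf, fun m c hc => hN m c (hc.exists_corner hA)⟩

end ProductCount

/-! ### Integrality of the values at powers of `q` -/

section Integrality

/-- A polynomial taking values in `ℤ[q, q⁻¹]` at all large powers of `q` does so at all powers. -/
theorem mem_QIVP_of_eval_mem {q : ℕ} (hq : q ≠ 0) {f : ℚ[X]} (N : ℕ)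
    (h : ∀ m : ℕ, N ≤ m →
      f.eval ((q : ℚ) ^ m) ∈ Algebra.adjoin ℤ ({(q : ℚ), (q : ℚ)⁻¹} : Set ℚ)) :
    f ∈ QIVP q := by
  set A := Algebra.adjoin ℤ ({(q : ℚ), (q : ℚ)⁻¹} : Set ℚ) with hA
  have hqQ : (q : ℚ) ≠ 0 := Nat.cast_ne_zero.2 hq
  have hqA : (q : ℚ) ∈ A := Algebra.subset_adjoin (Set.mem_insert _ _)
  have hqA' : (q : ℚ)⁻¹ ∈ A := Algebra.subset_adjoin (Set.mem_insert_of_mem _ rfl)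
  suffices key : ∀ (n : ℕ) (f : ℚ[X]), f.degree < n →
      (∀ m : ℕ, N ≤ m → f.eval ((q : ℚ) ^ m) ∈ A) → ∀ k : ℤ, f.eval ((q : ℚ) ^ k) ∈ A by
    refine key (f.natDegree + 1) f ?_ h
    exact lt_of_le_of_lt degree_le_natDegree (by exact_mod_cast Nat.lt_succ_self _)
  intro n
  induction n with
  | zero =>
    intro f hf _ k
    have : f = 0 := by
      rw [← degree_eq_bot]
      exact Nat.WithBot.lt_zero_iff.1 (by simpa using hf)
    rw [this, eval_zero]
    exact zero_mem _
  | succ n ih =>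
    intro f hf hN
    -- The `q`-difference `f(qt) - q ^ n f(t)` cancels the coefficient of `t ^ n`, so the induction
    -- hypothesis applies to it.
    let g := f.comp (C (q : ℚ) * X) - C ((q : ℚ) ^ n) * f
    have hg : g.degree < n := by
      rw [degree_lt_iff_coeff_zero]
      intro k hk
      rw [coeff_sub, comp_C_mul_X_coeff, coeff_C_mul]
      rcases hk.eq_or_lt with rfl | hk
      · ring
      · rw [coeff_eq_zero_of_degree_lt (hf.trans_le (by exact_mod_cast hk))]
        ring
    have hge : ∀ k : ℤ, g.eval ((q : ℚ) ^ k) =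
        f.eval ((q : ℚ) ^ (k + 1)) - (q : ℚ) ^ n * f.eval ((q : ℚ) ^ k) := by
      intro k
      simp only [g, eval_sub, eval_comp, eval_mul, eval_C, eval_X]
      rw [zpow_add₀ hqQ, zpow_one, mul_comm (q : ℚ)]
    have hgA : ∀ k : ℤ, g.eval ((q : ℚ) ^ k) ∈ A := by
      refine ih g hg fun m hm => ?_
      have h1 := hge m
      rw [zpow_natCast, ← Nat.cast_succ, zpow_natCast] at h1
      rw [h1]
      exact sub_mem (hN _ (hm.trans (Nat.le_succ m))) (mul_mem (pow_mem hqA n) (hN m hm))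
    -- Descend from `N` by solving for the lower value: `f(q ^ k) = q ^ (-n) (f(q ^ (k + 1)) - g(q ^
    -- k))`. This is where `q⁻¹` is needed.
    have hback : ∀ j : ℕ, f.eval ((q : ℚ) ^ ((N : ℤ) - j)) ∈ A := by
      intro j
      induction j with
      | zero =>
        rw [Nat.cast_zero, sub_zero, zpow_natCast]
        exact hN N le_rfl
      | succ j ihj =>
        have h1 := hge ((N : ℤ) - (j + 1 : ℕ))
        have h2 : (N : ℤ) - (j + 1 : ℕ) + 1 = (N : ℤ) - j := by push_cast; ring
        rw [h2] at h1
        have h3 : f.eval ((q : ℚ) ^ ((N : ℤ) - (j + 1 : ℕ))) = ((q : ℚ)⁻¹) ^ n *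
            (f.eval ((q : ℚ) ^ ((N : ℤ) - j)) -
              g.eval ((q : ℚ) ^ ((N : ℤ) - (j + 1 : ℕ)))) := by
          rw [h1, inv_pow, sub_sub_cancel, inv_mul_cancel_left₀ (pow_ne_zero n hqQ)]
        rw [h3]
        exact mul_mem (pow_mem hqA' n) (sub_mem ihj (hgA _))
    intro k
    rcases le_total (N : ℤ) k with hk | hk
    · lift k to ℕ using (Int.natCast_nonneg N).trans hk
      rw [zpow_natCast]
      exact hN k (by exact_mod_cast hk)
    · have := hback (N - k).toNat
      rwa [Int.toNat_of_nonneg (by omega), sub_sub_cancel] at this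

end Integrality

/-! ### Nonemptiness, finiteness and conjugation invariance of classes -/

section Classes

variable {F : Type*} [Field F]

/-- In block form `u = (1, 0, 0)ᵀ` and `v = (A, 1, 0)`. The second identity block makes `v`
surjective for every `A`, which explains the bound `2 * l`. -/
theorem exists_corner_factors {l : ℕ} (A : Matrix (Fin l) (Fin l) F) {m : ℕ} (hm : 2 * l ≤ m) :
    ∃ (u : Matrix (Fin m) (Fin l) F) (v : Matrix (Fin l) (Fin m) F),
      HasLeftInv u ∧ HasRightInv v ∧ v * u = A := by
  let e : Fin m ≃ Fin l ⊕ (Fin l ⊕ Fin (m - 2 * l)) :=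
    (finCongr (by omega)).trans (finSumFinEquiv.symm.trans
      (Equiv.sumCongr (Equiv.refl _) finSumFinEquiv.symm) :
        Fin (l + (l + (m - 2 * l))) ≃ Fin l ⊕ (Fin l ⊕ Fin (m - 2 * l)))
  let Z : Matrix (Fin l ⊕ Fin (m - 2 * l)) (Fin l) F := 0
  let W : Matrix (Fin l) (Fin l ⊕ Fin (m - 2 * l)) F := Matrix.fromCols 1 0
  refine ⟨(Matrix.fromRows 1 Z).submatrix e id, (Matrix.fromCols A W).submatrix id e,
    ⟨(Matrix.fromCols 1 0).submatrix id e, ?_⟩,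
    ⟨(Matrix.fromRows 0 (Matrix.fromRows 1 0)).submatrix e id, ?_⟩, ?_⟩
  · rw [Matrix.submatrix_mul_equiv, Matrix.fromCols_mul_fromRows, Matrix.mul_one, Matrix.zero_mul,
      add_zero, Matrix.submatrix_id_id]
  · rw [Matrix.submatrix_mul_equiv, Matrix.fromCols_mul_fromRows, Matrix.fromCols_mul_fromRows,
      Matrix.mul_one, Matrix.zero_mul, Matrix.mul_zero, zero_add, add_zero,
      Matrix.submatrix_id_id]
  · rw [Matrix.submatrix_mul_equiv, Matrix.fromCols_mul_fromRows, Matrix.mul_one, Matrix.mul_zero,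
      add_zero, Matrix.submatrix_id_id]

variable [Fintype F]

theorem exists_one_add_type (μ : MultiPart F) :
    ∃ A : Matrix (Fin μ.size) (Fin μ.size) F, MatrixHasType (1 + A) μ := by
  obtain ⟨N, hN⟩ := exists_matrix_of_type μ
  exact ⟨N - 1, by rwa [add_sub_cancel]⟩

theorem exists_hasModifiedType (μ : MultiPart F) {m : ℕ} (hm : 2 * μ.size ≤ m) :
    ∃ g : GL (Fin m) F, HasModifiedType g μ := by
  obtain ⟨A, hA⟩ := exists_one_add_type μ
  obtain ⟨u, v, hu, hv, huv⟩ := exists_corner_factors A hm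
  have hunit : IsUnit (1 + u * v) := by
    rw [Matrix.isUnit_iff_isUnit_det, Matrix.det_one_add_mul_comm,
      ← Matrix.isUnit_iff_isUnit_det, huv]
    exact hA.isUnit
  obtain ⟨g, hg⟩ := hunit
  refine ⟨g, (hasModifiedType_iff g μ).2 ?_⟩
  rw [hg, add_sub_cancel_left]
  exact ⟨u, v, hu, hv, rfl, by rwa [Matrix.mul_one, huv]⟩

theorem exists_modifiedType {m : ℕ} (g : GL (Fin m) F) : ∃ μ, HasModifiedType g μ := by
  obtain ⟨μ, hμ⟩ := exists_matrixHasType g.isUnit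
  exact ⟨μ.modified, μ, hμ, rfl⟩

theorem HasModifiedType.unique {m : ℕ} {g : GL (Fin m) F} {μ ν : MultiPart F}
    (hμ : HasModifiedType g μ) (hν : HasModifiedType g ν) : μ = ν := by
  obtain ⟨μ₀, h, rfl⟩ := hμ
  obtain ⟨ν₀, h', rfl⟩ := hν
  rw [MatrixHasType.unique (N := (g : Matrix (Fin m) (Fin m) F)) h h']

/-- Choosing a matrix of each type embeds the types of size `k` in the finite set of `k × k`
matrices. -/
theorem finite_size_le (n : ℕ) : {μ : MultiPart F | μ.size ≤ n}.Finite := by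
  have h1 : ∀ k, {μ : MultiPart F | μ.size = k}.Finite := by
    intro k
    let φ : {μ : MultiPart F | μ.size = k} → Matrix (Fin k) (Fin k) F :=
      fun μ => (μ.2 : μ.1.size = k) ▸ (exists_matrix_of_type μ.1).choose
    have hφ : ∀ μ, MatrixHasType (φ μ) μ.1 := by
      rintro ⟨μ, rfl⟩
      exact (exists_matrix_of_type μ).choose_spec
    have : Finite {μ : MultiPart F | μ.size = k} := Finite.of_injective φ fun μ ν h =>
      Subtype.ext ((hφ μ).unique (h ▸ hφ ν))
    exact Set.toFinite _
  exact (Set.finite_Iic n).preimage' fun k _ => h1 k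

theorem MultiPart.eq_zero_of_size_eq_zero {μ : MultiPart F} (h : μ.size = 0) : μ = 0 := by
  ext1 p
  by_contra hp
  have h1 : p.1.natDegree * Part.size (μ p) = 0 :=
    (Finset.sum_eq_zero_iff.1 h) p (Finsupp.mem_support_iff.2 hp)
  rcases Nat.mul_eq_zero.1 h1 with h2 | h2
  · exact (Irreducible.natDegree_pos p.2.2.1).ne' h2
  · obtain ⟨i, hi⟩ := Multiset.exists_mem_of_ne_zero hp
    have := Multiset.sum_eq_zero_iff.1 h2 i (Multiset.mem_map_of_mem _ hi)
    exact i.pos.ne' this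

theorem hasModifiedType_zero_iff {m : ℕ} (g : GL (Fin m) F) :
    HasModifiedType g (0 : MultiPart F) ↔ g = 1 := by
  constructor
  · intro h
    obtain ⟨u, v, -, -, huv, -⟩ := (hasModifiedType_iff g 0).1 h
    have h0 : (0 : MultiPart F).size = 0 := Finsupp.sum_zero_index
    have : IsEmpty (Fin (0 : MultiPart F).size) := by rw [h0]; infer_instance
    refine Units.ext (sub_eq_zero.1 (huv.trans ?_))
    ext i j
    rw [Matrix.mul_apply, Finset.univ_eq_empty, Finset.sum_empty, Matrix.zero_apply]
  · rintro rfl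
    obtain ⟨μ, hμ⟩ := exists_modifiedType (1 : GL (Fin m) F)
    suffices h : μ = 0 from h ▸ hμ
    refine MultiPart.eq_zero_of_size_eq_zero ?_
    obtain ⟨u, v, hu, hv, huv, -⟩ := (hasModifiedType_iff _ μ).1 hμ
    rw [Units.val_one, sub_self] at huv
    have hv0 : v = 0 := hu.cancel (huv.symm.trans (Matrix.mul_zero u).symm)
    have h1 : (1 : Matrix (Fin μ.size) (Fin μ.size) F) = 0 :=
      hv.cancel (by rw [hv0, Matrix.mul_zero, Matrix.mul_zero])
    by_contra hne
    have := congrFun (congrFun h1 ⟨0, Nat.pos_of_ne_zero hne⟩) ⟨0, Nat.pos_of_ne_zero hne⟩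
    rw [Matrix.one_apply_eq] at this
    exact one_ne_zero this

theorem hasModifiedType_conj_iff {m : ℕ} (x g : GL (Fin m) F) (μ : MultiPart F) :
    HasModifiedType (x * g * x⁻¹) μ ↔ HasModifiedType g μ := by
  have hx : HasLeftInv (x : Matrix (Fin m) (Fin m) F) := ⟨_, GL_inv_mul x⟩
  have hx' : HasRightInv ((x⁻¹ : GL (Fin m) F) : Matrix (Fin m) (Fin m) F) := ⟨_, GL_inv_mul x⟩
  have := isClass_mul_iff hx hx' ((g : Matrix (Fin m) (Fin m) F) - 1) μ
  rw [GL_inv_mul, Matrix.mul_sub, Matrix.sub_mul, Matrix.mul_one, GL_mul_inv] at this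
  rw [hasModifiedType_iff, hasModifiedType_iff, Units.val_mul, Units.val_mul, this]

end Classes

/-! ### Class sums in the group algebra -/

section ClassSums

variable {F : Type*} [Field F] [Fintype F] {m : ℕ}

open Classical in
theorem coeff_classSum (μ : MultiPart F) (g : GL (Fin m) F) :
    (classSum m μ).coeff g = if HasModifiedType g μ then 1 else 0 := by
  rw [classSum, MonoidAlgebra.coeff_sum, Finsupp.finsetSum_apply]
  simp only [MonoidAlgebra.coeff_single, Finsupp.single_apply]
  rw [Finset.sum_ite_eq']
  simp

theorem classSum_zero : classSum (F := F) m 0 = 1 := by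
  classical
  simp only [classSum, hasModifiedType_zero_iff]
  rw [Finset.filter_eq', if_pos (Finset.mem_univ _), Finset.sum_singleton]
  rfl

/-- Modified types are conjugation invariant, so class sums commute with every group element. -/
theorem classSum_mul_comm (μ ν : MultiPart F) :
    classSum m μ * classSum m ν = classSum m ν * classSum m μ := by
  classical
  suffices h : ∀ g : GL (Fin m) F,
      Commute (classSum m μ) (MonoidAlgebra.single g (1 : ℚ)) from
    Commute.sum_right _ _ _ fun g _ => h g
  intro g
  refine MonoidAlgebra.coeff_injective (Finsupp.ext fun k => ?_)
  rw [MonoidAlgebra.coeff_mul_single_eq_coeff_mul (k * g⁻¹) fun _ _ => eq_mul_inv_iff_mul_eq.symm,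
    MonoidAlgebra.coeff_single_mul_eq_mul_coeff (g⁻¹ * k) fun _ _ => eq_inv_mul_iff_mul_eq.symm,
    mul_one, one_mul, coeff_classSum, coeff_classSum]
  congr 1
  rw [← hasModifiedType_conj_iff g⁻¹ (k * g⁻¹), inv_inv]
  congr! 1
  group

theorem coeff_classSum_mul (μ ν : MultiPart F) (k : GL (Fin m) F) :
    (classSum m μ * classSum m ν).coeff k =
      Nat.card (FactorPair μ ν ((k : Matrix (Fin m) (Fin m) F) - 1)) := by
  classical
  have h1 : (classSum m μ * classSum m ν).coeff k =
      ∑ g : GL (Fin m) F with HasModifiedType g μ,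
        ∑ h : GL (Fin m) F with HasModifiedType h ν, if g * h = k then (1 : ℚ) else 0 := by
    rw [classSum, classSum, Finset.sum_mul_sum, MonoidAlgebra.coeff_sum, Finsupp.finsetSum_apply]
    refine Finset.sum_congr rfl fun g _ => ?_
    rw [MonoidAlgebra.coeff_sum, Finsupp.finsetSum_apply]
    refine Finset.sum_congr rfl fun h _ => ?_
    rw [MonoidAlgebra.single_mul_single, MonoidAlgebra.coeff_single, Finsupp.single_apply, mul_one]
  rw [h1, ← Finset.sum_product', Finset.sum_boole]
  congr 1
  rw [← Fintype.card_coe, ← Nat.card_eq_fintype_card]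
  refine Nat.card_congr (Equiv.ofBijective (fun x => ⟨((x.1.1 : Matrix (Fin m) (Fin m) F) - 1,
    (x.1.2 : Matrix (Fin m) (Fin m) F) - 1), ?_⟩) ⟨fun x y h => ?_, ?_⟩)
  · have hx := x.2
    simp only [Finset.mem_filter, Finset.mem_product, Finset.mem_univ, true_and] at hx
    refine ⟨(hasModifiedType_iff _ _).1 hx.1.1, (hasModifiedType_iff _ _).1 hx.1.2, ?_⟩
    rw [add_sub_cancel, add_sub_cancel, add_sub_cancel, ← Units.val_mul, hx.2]
  · obtain ⟨ha, hb⟩ := Prod.ext_iff.1 (congrArg Subtype.val h)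
    exact Subtype.ext (Prod.ext (Units.ext (sub_left_injective ha))
      (Units.ext (sub_left_injective hb)))
  · rintro ⟨⟨a, b⟩, ha, hb, hab⟩
    simp only at ha hb hab
    rw [add_sub_cancel] at hab
    -- A factor pair consists of plain matrices; invertibility of both factors follows from that of
    -- the product.
    have hdet : IsUnit ((1 + a).det * (1 + b).det) := by
      rw [← Matrix.det_mul, hab, ← Matrix.isUnit_iff_isUnit_det]
      exact k.isUnit
    obtain ⟨g, hg⟩ := (Matrix.isUnit_iff_isUnit_det _).2 (isUnit_of_mul_isUnit_left hdet)
    obtain ⟨h, hh⟩ := (Matrix.isUnit_iff_isUnit_det _).2 (isUnit_of_mul_isUnit_right hdet)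
    have ha' : (g : Matrix (Fin m) (Fin m) F) - 1 = a := by rw [hg, add_sub_cancel_left]
    have hb' : (h : Matrix (Fin m) (Fin m) F) - 1 = b := by rw [hh, add_sub_cancel_left]
    refine ⟨⟨(g, h), ?_⟩, Subtype.ext (Prod.ext ha' hb')⟩
    simp only [Finset.mem_filter, Finset.mem_product, Finset.mem_univ, true_and]
    refine ⟨⟨(hasModifiedType_iff _ _).2 (ha' ▸ ha), (hasModifiedType_iff _ _).2 (hb' ▸ hb)⟩, ?_⟩
    exact Units.ext (by rw [Units.val_mul, hg, hh, hab])

end ClassSums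

/-! ### The interpolating family: existence, uniqueness and degree -/

section StructurePolynomials

variable {F : Type*} [Field F] [Fintype F]

theorem exists_structurePolynomial (μ ν lam : MultiPart F) :
    ∃ f : QIVP (Fintype.card F),
      ((f : ℚ[X]) = 0 ∨ (f : ℚ[X]).natDegree + 2 * lam.size ≤ 2 * (μ.size + ν.size)) ∧
      ∀ (m : ℕ) (g : GL (Fin m) F), HasModifiedType g lam →
        (classSum m μ * classSum m ν).coeff g = (f : ℚ[X]).eval ((Fintype.card F : ℚ) ^ m) := by
  obtain ⟨A, hA⟩ := exists_one_add_type lam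
  obtain ⟨f, hf, hN⟩ := isPolynomialCount_factorPair μ ν lam hA
  have hN' : ∀ (m : ℕ) (g : GL (Fin m) F), HasModifiedType g lam →
      (classSum m μ * classSum m ν).coeff g = f.eval ((Fintype.card F : ℚ) ^ m) := by
    intro m g hg
    rw [coeff_classSum_mul, ← hN m _ ((hasModifiedType_iff g lam).1 hg)]
  refine ⟨⟨f, mem_QIVP_of_eval_mem Fintype.card_ne_zero (2 * lam.size) fun m hm => ?_⟩, hf, hN'⟩
  obtain ⟨g, hg⟩ := exists_hasModifiedType lam hm
  rw [← hN' m g hg, coeff_classSum_mul]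
  exact natCast_mem _ _

/-- Evaluate the coefficients at `q ^ m` and replace the symbols by class sums. -/
def specialize (m : ℕ) :
    (MultiPart F →₀ QIVP (Fintype.card F)) →+ MonoidAlgebra ℚ (GL (Fin m) F) where
  toFun x := x.sum fun lam c => (c : ℚ[X]).eval ((Fintype.card F : ℚ) ^ m) • classSum m lam
  map_zero' := Finsupp.sum_zero_index
  map_add' x y := Finsupp.sum_add_index' (fun lam => by
      rw [ZeroMemClass.coe_zero, eval_zero, zero_smul]) fun lam c d => by
      rw [Subring.coe_add, eval_add, add_smul]

theorem specialize_single (m : ℕ) (lam : MultiPart F) (c : QIVP (Fintype.card F)) :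
    specialize m (Finsupp.single lam c) =
      (c : ℚ[X]).eval ((Fintype.card F : ℚ) ^ m) • classSum m lam := by
  refine Finsupp.sum_single_index (h := fun (lam : MultiPart F) (c : QIVP (Fintype.card F)) =>
    (c : ℚ[X]).eval ((Fintype.card F : ℚ) ^ m) • classSum m lam) ?_
  rw [ZeroMemClass.coe_zero, eval_zero, zero_smul]

/-- Distinct class sums have disjoint supports, so an element of the class of `lam` sees only the
coefficient at `lam`. -/
theorem coeff_specialize {m : ℕ} {g : GL (Fin m) F} {lam : MultiPart F}
    (hg : HasModifiedType g lam) (x : MultiPart F →₀ QIVP (Fintype.card F)) :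
    (specialize m x).coeff g = (x lam : ℚ[X]).eval ((Fintype.card F : ℚ) ^ m) := by
  classical
  induction x using Finsupp.induction_linear with
  | zero => rw [map_zero, Finsupp.zero_apply, ZeroMemClass.coe_zero, eval_zero]; rfl
  | add x y hx hy =>
    rw [map_add, MonoidAlgebra.coeff_add, Finsupp.add_apply, hx, hy, Finsupp.add_apply,
      Subring.coe_add, eval_add]
  | single κ c =>
    rw [specialize_single, MonoidAlgebra.coeff_smul_apply, coeff_classSum, Finsupp.single_apply]
    by_cases h : κ = lam
    · rw [if_pos h, if_pos (h ▸ hg), smul_eq_mul, mul_one]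
    · rw [if_neg h, if_neg fun h' => h (h'.unique hg), smul_zero, ZeroMemClass.coe_zero, eval_zero]

theorem eq_of_eval_eq {f g : ℚ[X]} {q : ℕ} (hq : 1 < q) (N : ℕ)
    (h : ∀ m : ℕ, N ≤ m → f.eval ((q : ℚ) ^ m) = g.eval ((q : ℚ) ^ m)) : f = g := by
  refine eq_of_infinite_eval_eq f g ?_
  have hinj : Function.Injective fun m : ℕ => (q : ℚ) ^ m :=
    pow_right_injective₀ (by exact_mod_cast (by omega : 0 < q)) (by exact_mod_cast hq.ne')
  refine ((Set.Ici_infinite N).image hinj.injOn).mono ?_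
  rintro _ ⟨m, hm, rfl⟩
  exact h m hm

/-- For `m ≥ 2 * lam.size` the class of `lam` is nonempty, so the coefficient at `lam` is known at
infinitely many powers of `q`. -/
theorem specialize_injective {x y : MultiPart F →₀ QIVP (Fintype.card F)}
    (h : ∀ m, specialize m x = specialize m y) : x = y := by
  ext1 lam
  refine Subtype.ext (eq_of_eval_eq (Fintype.one_lt_card (α := F)) (2 * lam.size) fun m hm => ?_)
  obtain ⟨g, hg⟩ := exists_hasModifiedType lam hm
  rw [← coeff_specialize hg, ← coeff_specialize hg, h]

theorem exists_interpolates (F : Type*) [Field F] [Fintype F] :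
    ∃ r : Family F, Interpolates r ∧ ∀ μ ν lam : MultiPart F, (r μ ν lam : ℚ[X]) = 0 ∨
      (r μ ν lam : ℚ[X]).natDegree + 2 * lam.size ≤ 2 * (μ.size + ν.size) := by
  choose f hf hN using exists_structurePolynomial (F := F)
  -- The degree bound annihilates every `lam` with `|lam| > |μ| + |ν|`.
  have hfin : ∀ μ ν, (Function.support (f μ ν)).Finite := fun μ ν => by
    refine (finite_size_le (μ.size + ν.size)).subset fun lam hlam => ?_
    rcases hf μ ν lam with h | h
    · exact absurd (Subtype.ext h) hlam
    · change lam.size ≤ _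
      omega
  refine ⟨fun μ ν => Finsupp.ofSupportFinite (f μ ν) (hfin μ ν), fun m μ ν => ?_, hf⟩
  change _ = specialize m _
  refine MonoidAlgebra.coeff_injective (Finsupp.ext fun g => ?_)
  obtain ⟨lam, hg⟩ := exists_modifiedType g
  rw [coeff_specialize hg, hN μ ν lam m g hg]
  rfl

theorem Interpolates.specialize_eq {r : Family F} (h : Interpolates r) (m : ℕ)
    (μ ν : MultiPart F) : specialize m (r μ ν) = classSum m μ * classSum m ν :=
  (h m μ ν).symm

theorem Interpolates.unique {r r' : Family F} (h : Interpolates r) (h' : Interpolates r') :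
    r = r' := by
  funext μ ν
  refine specialize_injective fun m => ?_
  rw [h.specialize_eq, h'.specialize_eq]

theorem Interpolates.natDegree_le {r : Family F} (h : Interpolates r) (μ ν lam : MultiPart F) :
    (r μ ν lam : ℚ[X]) = 0 ∨
      (r μ ν lam : ℚ[X]).natDegree + 2 * lam.size ≤ 2 * (μ.size + ν.size) := by
  obtain ⟨r', h', hd⟩ := exists_interpolates F
  rw [h.unique h']
  exact hd μ ν lam

theorem Interpolates.eq_zero_of_size_lt {r : Family F} (h : Interpolates r)
    {μ ν lam : MultiPart F} (hl : μ.size + ν.size < lam.size) : r μ ν lam = 0 := by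
  rcases h.natDegree_le μ ν lam with h | h
  · exact Subtype.ext h
  · omega

/-- The structure polynomials of top degree are constants, equal to integers. -/
theorem Interpolates.exists_int {r : Family F} (h : Interpolates r) {μ ν lam : MultiPart F}
    (hl : μ.size + ν.size = lam.size) : ∃ c : ℤ, r μ ν lam = c := by
  have hdeg : (r μ ν lam : ℚ[X]).natDegree = 0 := by
    rcases h.natDegree_le μ ν lam with h | h
    · rw [h, natDegree_zero]
    · omega
  obtain ⟨a, ha⟩ := natDegree_eq_zero.1 hdeg
  -- One value suffices for a constant: at an element of the class it is the number of
  -- factorizations.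
  obtain ⟨g, hg⟩ := exists_hasModifiedType lam le_rfl
  have h1 := coeff_specialize hg (r μ ν)
  rw [h.specialize_eq, coeff_classSum_mul, ← ha, eval_C] at h1
  refine ⟨Nat.card (FactorPair μ ν ((g : Matrix (Fin (2 * lam.size)) (Fin (2 * lam.size)) F) - 1)), Subtype.ext ?_⟩
  rw [← ha, ← h1]
  simp

end StructurePolynomials

/-! ### The filtered algebra and its specializations -/

section Algebra

variable {F : Type*} [Field F] [Fintype F] {r : Family F}

theorem FH.single_eq (μ : MultiPart F) (c : QIVP (Fintype.card F)) :
    (Finsupp.single μ c : MultiPart F →₀ QIVP (Fintype.card F)) = (c • FH.K r μ : FH r) := by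
  change _ = c • (Finsupp.single μ 1 : MultiPart F →₀ QIVP (Fintype.card F))
  rw [Finsupp.smul_single, smul_eq_mul, mul_one]

@[elab_as_elim]
theorem FH.induction {p : FH r → Prop} (x : FH r) (zero : p 0)
    (add : ∀ x y, p x → p y → p (x + y))
    (smul : ∀ (c : QIVP (Fintype.card F)) (μ : MultiPart F), p (c • FH.K r μ)) : p x :=
  Finsupp.induction_linear (motive := fun y => p (y : FH r)) x zero (fun x y => add x y)
    fun μ c => by
      have := smul c μ
      rwa [← FH.single_eq] at this

/-- Specialization of the Farahat–Higman algebra to the group algebra of `GL_m`. -/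
def FH.specialize (r : Family F) (m : ℕ) : FH r →+ MonoidAlgebra ℚ (GL (Fin m) F) :=
  FarahatHigman.specialize m

theorem FH.specialize_smul_K (m : ℕ) (c : QIVP (Fintype.card F)) (μ : MultiPart F) :
    FH.specialize r m (c • FH.K r μ) =
      (c : ℚ[X]).eval ((Fintype.card F : ℚ) ^ m) • classSum m μ := by
  rw [← FH.single_eq]
  exact specialize_single m μ c

theorem FH.specialize_K (m : ℕ) (μ : MultiPart F) :
    FH.specialize r m (FH.K r μ) = classSum m μ := by
  rw [← one_smul (QIVP (Fintype.card F)) (FH.K r μ), FH.specialize_smul_K, OneMemClass.coe_one,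
    eval_one, one_smul]

theorem FH.specialize_smul (m : ℕ) (c : QIVP (Fintype.card F)) (x : FH r) :
    FH.specialize r m (c • x) =
      (c : ℚ[X]).eval ((Fintype.card F : ℚ) ^ m) • FH.specialize r m x := by
  induction x using FH.induction with
  | zero => rw [smul_zero, map_zero, smul_zero]
  | add x y hx hy => rw [smul_add, map_add, hx, hy, map_add, smul_add]
  | smul d μ => rw [smul_smul, FH.specialize_smul_K, FH.specialize_smul_K, smul_smul,
      Subring.coe_mul, eval_mul]

theorem FH.specialize_injective {x y : FH r}
    (h : ∀ m, FH.specialize r m x = FH.specialize r m y) : x = y :=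
  FarahatHigman.specialize_injective h

theorem FH.sum_smul_K (x : MultiPart F →₀ QIVP (Fintype.card F)) :
    (x.sum fun lam c => c • FH.K r lam) = (x : FH r) := by
  refine Eq.trans ?_ (Finsupp.sum_single x)
  exact Finsupp.sum_congr fun lam _ => (FH.single_eq lam _).symm

theorem FH.specialize_K_mul_K (hr : Interpolates r) (m : ℕ) (μ ν : MultiPart F) :
    FH.specialize r m (FH.K r μ * FH.K r ν) = classSum m μ * classSum m ν := by
  rw [FH.K_mul_K, FH.sum_smul_K]
  exact hr.specialize_eq m μ ν

/-- Multiplicativity on the symbols is the interpolation property; bilinearity extends it. The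
algebra laws can then be checked in the group algebras. -/
theorem FH.specialize_mul (hr : Interpolates r) (m : ℕ) (x y : FH r) :
    FH.specialize r m (x * y) = FH.specialize r m x * FH.specialize r m y := by
  induction x using FH.induction with
  | zero => rw [zero_mul, map_zero, zero_mul]
  | add x x' hx hx' => rw [add_mul, map_add, hx, hx', map_add, add_mul]
  | smul c μ =>
    induction y using FH.induction with
    | zero => rw [mul_zero, map_zero, mul_zero]
    | add y y' hy hy' => rw [mul_add, map_add, hy, hy', map_add, mul_add]
    | smul d ν =>
      rw [smul_mul_assoc, mul_smul_comm, FH.specialize_smul, FH.specialize_smul,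
        FH.specialize_K_mul_K hr, FH.specialize_smul_K, FH.specialize_smul_K, smul_mul_assoc,
        mul_smul_comm]

theorem FH.specialize_mul_comm (m : ℕ) (x y : FH r) :
    FH.specialize r m x * FH.specialize r m y = FH.specialize r m y * FH.specialize r m x := by
  induction x using FH.induction with
  | zero => rw [map_zero, zero_mul, mul_zero]
  | add x x' hx hx' => rw [map_add, add_mul, mul_add, hx, hx']
  | smul c μ =>
    induction y using FH.induction with
    | zero => rw [map_zero, zero_mul, mul_zero]
    | add y y' hy hy' => rw [map_add, add_mul, mul_add, hy, hy']
    | smul d ν =>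
      rw [FH.specialize_smul_K, FH.specialize_smul_K, smul_mul_smul_comm, smul_mul_smul_comm,
        classSum_mul_comm, mul_comm (eval _ _)]

theorem FH.filtration_mono : Monotone (FH.filtration r) := by
  intro i j hij
  refine Submodule.span_mono ?_
  rintro _ ⟨μ, hμ, rfl⟩
  exact ⟨μ, hμ.trans hij, rfl⟩

theorem FH.K_mem_of_le {μ : MultiPart F} {d : ℕ} (h : μ.size ≤ d) :
    FH.K r μ ∈ FH.filtration r d :=
  FH.filtration_mono h (FH.K_mem r μ)

theorem FH.mul_mem_filtration (hr : Interpolates r) {i j : ℕ} {x y : FH r}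
    (hx : x ∈ FH.filtration r i) (hy : y ∈ FH.filtration r j) :
    x * y ∈ FH.filtration r (i + j) := by
  induction hx using Submodule.span_induction with
  | zero => rw [zero_mul]; exact zero_mem _
  | add x x' _ _ h h' => rw [add_mul]; exact add_mem h h'
  | smul c x _ h => rw [smul_mul_assoc]; exact Submodule.smul_mem _ c h
  | mem x hx =>
    obtain ⟨μ, hμ, rfl⟩ := hx
    induction hy using Submodule.span_induction with
    | zero => rw [mul_zero]; exact zero_mem _
    | add y y' _ _ h h' => rw [mul_add]; exact add_mem h h'
    | smul c y _ h => rw [mul_smul_comm]; exact Submodule.smul_mem _ c h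
    | mem y hy =>
      obtain ⟨ν, hν, rfl⟩ := hy
      rw [FH.K_mul_K]
      refine Submodule.sum_mem _ fun lam hlam => Submodule.smul_mem _ _ (FH.K_mem_of_le ?_)
      by_contra hlt
      exact Finsupp.mem_support_iff.1 hlam (hr.eq_zero_of_size_lt (by omega))

theorem FH.isFilteredCommAlgebra (hr : Interpolates r) :
    IsFilteredCommAlgebra (FH.filtration r) where
  mul_assoc x y z := FH.specialize_injective fun m => by
    simp only [FH.specialize_mul hr, mul_assoc]
  mul_comm x y := FH.specialize_injective fun m => by
    rw [FH.specialize_mul hr, FH.specialize_mul hr, FH.specialize_mul_comm]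
  one_mul x := FH.specialize_injective fun m => by
    have h1 : FH.specialize r m 1 = 1 := (FH.specialize_K m 0).trans classSum_zero
    rw [FH.specialize_mul hr, h1, one_mul]
  mono := FH.filtration_mono
  one_mem := FH.K_mem_of_le (Finsupp.sum_zero_index (h := fun p s => p.1.natDegree * Part.size s)).le
  mul_mem i j x y hx hy := FH.mul_mem_filtration hr hx hy
  exhaustive x := by
    induction x using FH.induction with
    | zero => exact ⟨0, zero_mem _⟩
    | add x y hx hy =>
      obtain ⟨i, hi⟩ := hx
      obtain ⟨j, hj⟩ := hy
      exact ⟨max i j, add_mem (FH.filtration_mono (le_max_left i j) hi)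
        (FH.filtration_mono (le_max_right i j) hj)⟩
    | smul c μ => exact ⟨μ.size, Submodule.smul_mem _ c (FH.K_mem r μ)⟩

end Algebra

/-! ### The associated graded algebra and its basis of symbols -/

section Graded

variable {F : Type*} [Field F] [Fintype F] (r : Family F)

theorem FH.coord_eq_zero_of_mem_below {lam : MultiPart F} {x : FH r}
    (hx : x ∈ below (FH.filtration r) lam.size) : (FH.basis r).coord lam x = 0 := by
  have : below (FH.filtration r) lam.size ≤ LinearMap.ker ((FH.basis r).coord lam) := by
    refine iSup_le fun i => Submodule.span_le.2 ?_
    rintro _ ⟨μ, hμ, rfl⟩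
    change (FH.basis r).repr (FH.basis r μ) lam = 0
    rw [Module.Basis.repr_self, Finsupp.single_apply_eq_zero]
    rintro rfl
    exact absurd hμ (not_le.2 i.2)
  exact this hx

open Classical in
/-- The coordinate at `lam` of an element of `F_d / F_{d-1}`. -/
def FH.pieceCoord (lam : MultiPart F) (d : ℕ) :
    GrPiece (FH.filtration r) d →ₗ[QIVP (Fintype.card F)] QIVP (Fintype.card F) :=
  -- In degree `|lam|` the coordinate vanishes on lower filtration pieces, hence descends; in all
  -- other degrees it is set to zero.
  Submodule.liftQ _ (if d = lam.size then (FH.basis r).coord lam ∘ₗ (FH.filtration r d).subtype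
    else 0) (by
    intro x hx
    rw [LinearMap.mem_ker]
    split_ifs with h
    · subst h
      exact FH.coord_eq_zero_of_mem_below r hx
    · rfl)

/-- The coordinate at `lam` of an element of the associated graded algebra. -/
def FH.gradedCoord (lam : MultiPart F) :
    AssocGraded (FH.filtration r) →ₗ[QIVP (Fintype.card F)] QIVP (Fintype.card F) :=
  DirectSum.toModule _ ℕ _ (FH.pieceCoord r lam)

open Classical in
theorem FH.gradedCoord_of (lam : MultiPart F) (d : ℕ) (x : FH.filtration r d) :
    FH.gradedCoord r lam (DirectSum.of (GrPiece (FH.filtration r)) d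
      (GrPiece.mk (FH.filtration r) d x)) =
      if d = lam.size then (FH.basis r).coord lam x else 0 := by
  refine (DirectSum.toModule_lof _ _ _).trans ?_
  change (if d = lam.size then (FH.basis r).coord lam ∘ₗ (FH.filtration r d).subtype
    else 0) x = _
  split_ifs <;> rfl

open Classical in
theorem FH.gradedCoord_symbol (lam μ : MultiPart F) :
    FH.gradedCoord r lam (FH.symbol r μ) = if μ = lam then 1 else 0 := by
  rw [FH.symbol, FH.gradedCoord_of]
  change (if μ.size = lam.size then (FH.basis r).repr (FH.basis r μ) lam else 0) = _
  rw [Module.Basis.repr_self, Finsupp.single_apply]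
  by_cases h : μ = lam
  · rw [if_pos h, if_pos (congrArg _ h)]
  · rw [if_neg h, ite_self]

theorem FH.span_symbol : ⊤ ≤ Submodule.span (QIVP (Fintype.card F)) (Set.range (FH.symbol r)) := by
  rintro x -
  induction x using DirectSum.induction_on with
  | zero => exact zero_mem _
  | add x y hx hy => exact add_mem hx hy
  | of d x =>
    obtain ⟨⟨y, hy⟩, rfl⟩ := Submodule.mkQ_surjective _ x
    change DirectSum.lof (QIVP (Fintype.card F)) ℕ (GrPiece (FH.filtration r)) d
      (GrPiece.mk (FH.filtration r) d ⟨y, hy⟩) ∈ _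
    induction hy using Submodule.span_induction with
    | zero =>
      have : (⟨0, zero_mem _⟩ : FH.filtration r d) = 0 := rfl
      rw [this, map_zero, map_zero]
      exact zero_mem _
    | add y y' hy hy' h h' =>
      have : (⟨y + y', add_mem hy hy'⟩ : FH.filtration r d) = ⟨y, hy⟩ + ⟨y', hy'⟩ := rfl
      rw [this, map_add, map_add]
      exact add_mem h h'
    | smul c y hy h =>
      have : (⟨c • y, Submodule.smul_mem _ c hy⟩ : FH.filtration r d) = c • ⟨y, hy⟩ := rfl
      rw [this, map_smul, map_smul]
      exact Submodule.smul_mem _ c h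
    | mem y hy =>
      obtain ⟨μ, hμ, rfl⟩ := hy
      rcases hμ.eq_or_lt with rfl | hlt
      · exact Submodule.subset_span ⟨μ, rfl⟩
      -- A symbol of smaller size already lies in an earlier piece, so its class in degree `d` is
      -- zero.
      · have : GrPiece.mk (FH.filtration r) d ⟨FH.K r μ, FH.K_mem_of_le hμ⟩ = 0 := by
          refine (Submodule.Quotient.mk_eq_zero _).2 ?_
          exact Submodule.mem_iSup_of_mem (⟨μ.size, hlt⟩ : Fin d) (FH.K_mem r μ)
        rw [this, map_zero]
        exact zero_mem _

theorem linearIndependent_of_dual {R M ι : Type*} [CommSemiring R] [AddCommMonoid M] [Module R M]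
    (v : ι → M) (f : ι → M →ₗ[R] R) (h₁ : ∀ i, f i (v i) = 1)
    (h₀ : ∀ i j, j ≠ i → f i (v j) = 0) : LinearIndependent R v := by
  classical
  intro x y hxy
  have key : ∀ i, f i ∘ₗ Finsupp.linearCombination R v = Finsupp.lapply i := by
    intro i
    refine Finsupp.lhom_ext fun j c => ?_
    rw [LinearMap.comp_apply, Finsupp.linearCombination_single, map_smul, Finsupp.lapply_apply,
      Finsupp.single_apply]
    split_ifs with hji
    · rw [hji, h₁, smul_eq_mul, mul_one]
    · rw [h₀ i j hji, smul_zero]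
  ext i
  have := congrArg (f i) hxy
  rwa [← LinearMap.comp_apply, ← LinearMap.comp_apply, key] at this

theorem FH.linearIndependent_symbol :
    LinearIndependent (QIVP (Fintype.card F)) (FH.symbol r) := by
  classical
  exact linearIndependent_of_dual (FH.symbol r) (FH.gradedCoord r)
    (fun μ => (FH.gradedCoord_symbol r μ μ).trans (if_pos rfl))
    (fun lam μ h => (FH.gradedCoord_symbol r lam μ).trans (if_neg h))

/-- The symbols of the `K_μ` form a basis of the associated graded algebra. -/
def FH.symbolBasis : Module.Basis (MultiPart F) (QIVP (Fintype.card F))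
    (AssocGraded (FH.filtration r)) :=
  Module.Basis.mk (FH.linearIndependent_symbol r) (FH.span_symbol r)

theorem FH.symbolBasis_apply (μ : MultiPart F) : FH.symbolBasis r μ = FH.symbol r μ :=
  Module.Basis.mk_apply _ _ μ

theorem FH.symbolBasis_coord (lam : MultiPart F) :
    (FH.symbolBasis r).coord lam = FH.gradedCoord r lam := by
  classical
  refine (FH.symbolBasis r).ext fun μ => ?_
  rw [FH.symbolBasis_apply, FH.gradedCoord_symbol, Module.Basis.coord_apply,
    ← FH.symbolBasis_apply, Module.Basis.repr_self, Finsupp.single_apply]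

/-- In degree `|μ| + |ν|` the coordinate at `lam` is `r μ ν lam` when the sizes match, an integer by
`Interpolates.exists_int`, and zero otherwise. -/
theorem FH.exists_int_repr_mul {r : Family F} (hr : Interpolates r)
    [SetLike.GradedMul (FH.filtration r)] (μ ν lam : MultiPart F) :
    ∃ c : ℤ, (FH.symbolBasis r).repr (FH.symbolBasis r μ * FH.symbolBasis r ν) lam = c := by
  classical
  rw [← Module.Basis.coord_apply, FH.symbolBasis_coord, FH.symbolBasis_apply,
    FH.symbolBasis_apply, FH.symbol, FH.symbol, DirectSum.of_mul_of]
  have h1 := FH.gradedCoord_of r lam (μ.size + ν.size)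
    ⟨FH.K r μ * FH.K r ν, SetLike.mul_mem_graded (FH.K_mem r μ) (FH.K_mem r ν)⟩
  have h2 : (FH.basis r).coord lam (FH.K r μ * FH.K r ν) = r μ ν lam := by
    rw [FH.K_mul_K, FH.sum_smul_K]
    rfl
  simp only [h2] at h1
  by_cases h : μ.size + ν.size = lam.size
  · obtain ⟨c, hc⟩ := hr.exists_int h
    rw [if_pos h, hc] at h1
    exact ⟨c, h1⟩
  · rw [if_neg h] at h1
    exact ⟨0, h1.trans Int.cast_zero.symm⟩

end Graded

end FarahatHigman
end

theorem lemma6p5 (F : Type*) [Field F] [Fintype F] :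
    -- the interpolating polynomials exist and are unique
    (∃! r : FarahatHigman.Family F, FarahatHigman.Interpolates r) ∧
    ∀ r : FarahatHigman.Family F, FarahatHigman.Interpolates r →
      -- the degree bound (a nonzero polynomial forces the bound to be nonnegative)
      (∀ μ ν lam : FarahatHigman.MultiPart F, (r μ ν lam : Polynomial ℚ) ≠ 0 →
        ((r μ ν lam : Polynomial ℚ).natDegree : ℤ) ≤
          2 * ((μ.size : ℤ) + (ν.size : ℤ) - (lam.size : ℤ))) ∧
      -- the algebra is filtered, and its associated graded algebra has integer structure constants
      ∃ h : FarahatHigman.IsFilteredCommAlgebra (FarahatHigman.FH.filtration r),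
        haveI := h.gradedMul
        ∃ b : Module.Basis (FarahatHigman.MultiPart F) (FarahatHigman.QIVP (Fintype.card F))
            (FarahatHigman.AssocGraded (FarahatHigman.FH.filtration r)),
          (∀ μ, b μ = FarahatHigman.FH.symbol r μ) ∧
          ∀ μ ν lam : FarahatHigman.MultiPart F, ∃ c : ℤ, b.repr (b μ * b ν) lam = c := by
  refine ⟨?_, fun r hr => ⟨fun μ ν lam hne => ?_, FarahatHigman.FH.isFilteredCommAlgebra hr,
    FarahatHigman.FH.symbolBasis r, FarahatHigman.FH.symbolBasis_apply r, fun μ ν lam => ?_⟩⟩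
  · obtain ⟨r, hr, -⟩ := FarahatHigman.exists_interpolates F
    exact ⟨r, hr, fun r' hr' => hr'.unique hr⟩
  · have h := (hr.natDegree_le μ ν lam).resolve_left hne
    omega
  · have := (FarahatHigman.FH.isFilteredCommAlgebra hr).gradedMul
    exact FarahatHigman.FH.exists_int_repr_mul hr μ ν lam
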